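/- Let $n\ge 2$ and let $\Sigma=\{\pm(e_i+e_j),\pm(e_i-e_j),\pm e_i \mid i\ne j\}\subset\mathbb R^n$ be the root system of type $B_n$, with simple roots $\Theta=\{\alpha_1=e_1-e_2,\dots,\alpha_{n-1}=e_{n-1}-e_n,\alpha_n=e_n\}$, set $\Sigma^+$ of positive roots, and Weyl group $W$ with length function $\ell$ and Bruhat order $\le$. Write $s_\alpha$ for the reflection in the root $\alpha$. Let $\Theta_P,\Theta_Q\subseteq\Theta$ be arbitrary subsets, and let $W_P,W_Q\subseteq W$ be the subgroups generated by the corresponding simple reflections. Let $W^P$ and ${}^QW^P$ be the sets of minimal length representatives of $W/W_P$ and of $W_Q\backslash W/W_P$, and for $w\in W$ let $\overline w\in W^P$ and $\widehat w\in{}^QW^P$ be the representatives of $wW_P$ and of $W_QwW_P$. The parabolic moment graph $\mathcal G^P$ has vertex set $W^P$ and the edges $w\to\overline{s_\alpha w}$ labelled by $\alpha$, for all $w\in W^P$ and $\alpha\in\Sigma^+$ with $w\le s_\alpha w$ and $\overline{w}\ne\overline{s_\alpha w}$. A double moment graph ${}^Q\mathcal G^P$ has vertex set ${}^QW^P$ and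 an edge $u\to u'$ for all $u\neq u'$ in ${}^QW^P$ such that $u'=\widehat{s_\beta u}$ and $u\le s_\beta u$ for some $\beta\in\Sigma^+$, together with a choice, for each edge $u\to u'$, of one such root $\beta$ as its label $l(u\to u')$. It is viewed as the subgraph $\mathcal G'$ of $\mathcal G^P$ whose vertices are all $u\in{}^QW^P$ and all $\overline{s_{l(u\to u')}u}$, and whose edges are $u\to\overline{s_{l(u\to u')}u}$ with label $l(u\to u')$, for all edges $u\to u'$ of ${}^Q\mathcal G^P$. Let $w\in W_Q$ act on $W^P$ by $w(x)=\overline{wx}$. The closure $\langle{}^Q\mathcal G^P\rangle$ is the graph whose vertices are all $w(x)$, for $w\in W_Q$ and $x$ a vertex of $\mathcal G'$, and whose edges are: all edges of $\mathcal G^P$ of the form $w(x)\to v(x)$ with $v,w\in W_Q$ and $x$ a vertex of $\mathcal G'$; and, for each edge $x\to y$ of $\mathcal G'$ with label $\alpha$ and each $w\in W_Q$, the edge $w(x)\to w(y)$ with label $w(\alpha)$ if $w(\alpha)\in\Sigma^+$, and the edge $w(y)\to w(x)$ with label $-w(\alpha)$ if $-w(\alpha)\in\Sigma^+$. The double moment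 graph is called closed if $\langle{}^Q\mathcal G^P\rangle=\mathcal G^P$. Then a double moment graph ${}^Q\mathcal G^P$ (with any choice of labels) is closed if and only if at least one of the following holds: 1. there are $p,q\in\{1,\dots,n\}$ such that $\Theta_P=\{\alpha_p,\dots,\alpha_n\}$ and $\Theta_Q=\{\alpha_q,\dots,\alpha_n\}$; 2. $\alpha_n\notin\Theta_P$ and $\alpha_n\notin\Theta_Q$; 3. $\Theta_P=\Theta$ or $\Theta_Q=\Theta$; 4. $\Theta_P=\emptyset$ or $\Theta_Q=\emptyset$. -/

import Mathlib

/-!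
Parabolic and double moment graphs of a root system `Φ` with set of simple roots `Θ`, realized in
a Euclidean space `V`, and the root system of type `B`. Elements of Weyl groups are
linear isometries of `V`.
-/

noncomputable section

namespace DoubleMoment

section General

variable {V : Type*} [NormedAddCommGroup V] [InnerProductSpace ℝ V]

/-- The reflection `s_α` in the hyperplane orthogonal to `α`. -/
def refl (α : V) : V ≃ₗᵢ[ℝ] V := Submodule.reflection (Submodule.span ℝ {α})ᗮ

/-- The group generated by the reflections in the elements of `S`. For `S = Θ` this is the Weyl
group `W`, for `S = Θ_P` and `S = Θ_Q` it is `W_P` and `W_Q`. -/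
def weyl (S : Set V) : Subgroup (V ≃ₗᵢ[ℝ] V) := Subgroup.closure (refl '' S)

/-- The positive roots: the roots that are sums of simple roots (with repetitions). -/
def posRoots (Φ Θ : Set V) : Set V := {β | β ∈ Φ ∧ β ∈ AddSubmonoid.closure Θ}

/-- The length of `w ∈ W`: the least number of factors in an expression of `w` as
a product of simple reflections. -/
def length (Θ : Set V) (w : V ≃ₗᵢ[ℝ] V) : ℕ :=
  sInf {k | ∃ l : List V, l.length = k ∧ (∀ α ∈ l, α ∈ Θ) ∧ (l.map refl).prod = w}

/-- The Bruhat order on `W`: the reflexive and transitive closure of the relations `x < s_β x`, for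
`β` a positive root with `ℓ(x) < ℓ(s_β x)`. -/
def bruhatLE (Φ Θ : Set V) : (V ≃ₗᵢ[ℝ] V) → (V ≃ₗᵢ[ℝ] V) → Prop :=
  Relation.ReflTransGen fun x y =>
    ∃ β ∈ posRoots Φ Θ, y = refl β * x ∧ length Θ x < length Θ y

/-- The double coset `W_Q w W_P`. -/
def doubleCoset (ΘQ ΘP : Set V) (w : V ≃ₗᵢ[ℝ] V) : Set (V ≃ₗᵢ[ℝ] V) :=
  {x | ∃ a ∈ weyl ΘQ, ∃ b ∈ weyl ΘP, x = a * w * b}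

theorem doubleCoset_nonempty (ΘQ ΘP : Set V) (w : V ≃ₗᵢ[ℝ] V) :
    (doubleCoset ΘQ ΘP w).Nonempty :=
  ⟨w, 1, one_mem _, 1, one_mem _, by simp⟩

/-- The representative `ŵ` of minimal length of the double coset `W_Q w W_P`. -/
def hat (Θ ΘQ ΘP : Set V) (w : V ≃ₗᵢ[ℝ] V) : V ≃ₗᵢ[ℝ] V :=
  Function.argminOn (length Θ) (doubleCoset ΘQ ΘP w) (doubleCoset_nonempty ΘQ ΘP w)

/-- The representative `w̄` of minimal length of the left coset `w W_P`
(the case `Θ_Q = ∅`, in which `W_Q` is trivial). -/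
def bar (Θ ΘP : Set V) (w : V ≃ₗᵢ[ℝ] V) : V ≃ₗᵢ[ℝ] V := hat Θ ∅ ΘP w

/-- The set `^QW^P` of representatives of minimal length of `W_Q \ W / W_P`. -/
def doubleReps (Θ ΘQ ΘP : Set V) : Set (V ≃ₗᵢ[ℝ] V) :=
  {x | x ∈ weyl Θ ∧ ∀ y ∈ doubleCoset ΘQ ΘP x, length Θ x ≤ length Θ y}

/-- The set `W^P` of representatives of minimal length of `W / W_P`. -/
def leftReps (Θ ΘP : Set V) : Set (V ≃ₗᵢ[ℝ] V) := doubleReps Θ ∅ ΘP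

/-- A directed graph with labelled edges, on a set of elements of `W`: `edge x y α` says that there
is an edge `x → y` with label `α`. The order on the vertices is always the one induced by the Bruhat
order, so that two such graphs are equal as moment graphs iff they have the same vertices and the
same labelled edges. -/
@[ext]
structure LabelledGraph (V : Type*) [NormedAddCommGroup V] [InnerProductSpace ℝ V] where
  verts : Set (V ≃ₗᵢ[ℝ] V)
  edge : (V ≃ₗᵢ[ℝ] V) → (V ≃ₗᵢ[ℝ] V) → V → Prop

/-- The parabolic moment graph `𝒢^P`: its vertices are the elements of `W^P`, and its edges are
`w → \overline{s_α w}` with label `α`, for `w ≤ s_α w`, `w̄ ≠ \overline{s_α w}`, `α ∈ Σ⁺`. -/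
def parabolicGraph (Φ Θ ΘP : Set V) : LabelledGraph V where
  verts := leftReps Θ ΘP
  edge x y α :=
    x ∈ leftReps Θ ΘP ∧ α ∈ posRoots Φ Θ ∧ bruhatLE Φ Θ x (refl α * x) ∧
      bar Θ ΘP x ≠ bar Θ ΘP (refl α * x) ∧ y = bar Θ ΘP (refl α * x)

/-- The `H`-closure of a subgraph `𝒢'` of `𝒢`, where `w ∈ H` acts on vertices by
`x ↦ \overline{w x}`. -/
def hClosure (Φ Θ ΘP : Set V) (H : Subgroup (V ≃ₗᵢ[ℝ] V)) (𝒢 𝒢' : LabelledGraph V) :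
    LabelledGraph V where
  verts := {y | ∃ w ∈ H, ∃ x ∈ 𝒢'.verts, y = bar Θ ΘP (w * x)}
  edge y z γ :=
    (𝒢.edge y z γ ∧
      ∃ x ∈ 𝒢'.verts, ∃ w ∈ H, ∃ v ∈ H, y = bar Θ ΘP (w * x) ∧ z = bar Θ ΘP (v * x)) ∨
    (∃ a b α, 𝒢'.edge a b α ∧ ∃ w ∈ H, w α ∈ posRoots Φ Θ ∧
      y = bar Θ ΘP (w * a) ∧ z = bar Θ ΘP (w * b) ∧ γ = w α) ∨
    (∃ a b α, 𝒢'.edge a b α ∧ ∃ w ∈ H, -(w α) ∈ posRoots Φ Θ ∧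
      y = bar Θ ΘP (w * b) ∧ z = bar Θ ΘP (w * a) ∧ γ = -(w α))

/-- The positive roots that may label an edge `u → u'` of the double moment graph. -/
def admissibleLabels (Φ Θ ΘQ ΘP : Set V) (u u' : V ≃ₗᵢ[ℝ] V) : Set V :=
  {β | β ∈ posRoots Φ Θ ∧ u' = hat Θ ΘQ ΘP (refl β * u) ∧ bruhatLE Φ Θ u (refl β * u)}

/-- The edges `^QE^P` of the double moment graph on `^QW^P`. -/
def doubleEdge (Φ Θ ΘQ ΘP : Set V) (u u' : V ≃ₗᵢ[ℝ] V) : Prop :=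
  u ∈ doubleReps Θ ΘQ ΘP ∧ (∃ β, β ∈ admissibleLabels Φ Θ ΘQ ΘP u u') ∧ u ≠ u'

/-- A double moment graph `^Q𝒢^P`. Vertices `^QW^P` and edges `^QE^P` are determined by `Θ_P` and
`Θ_Q`, so the datum is the choice of one label for each edge
(the value of `label` at pairs that are not edges is irrelevant and never used). -/
structure DoubleMomentGraph (Φ Θ ΘQ ΘP : Set V) where
  label : (V ≃ₗᵢ[ℝ] V) → (V ≃ₗᵢ[ℝ] V) → V
  label_mem : ∀ u u', doubleEdge Φ Θ ΘQ ΘP u u' → label u u' ∈ admissibleLabels Φ Θ ΘQ ΘP u u'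

instance (Φ Θ ΘQ ΘP : Set V) : Nonempty (DoubleMomentGraph Φ Θ ΘQ ΘP) := by
  classical
  exact ⟨⟨fun u u' => if h : doubleEdge Φ Θ ΘQ ΘP u u' then h.2.1.choose else 0,
    fun u u' h => by simpa [h] using h.2.1.choose_spec⟩⟩

namespace DoubleMomentGraph

variable {Φ Θ ΘQ ΘP : Set V}

/-- The double moment graph viewed as a subgraph of `𝒢^P`: its vertices are all `u ∈ ^QW^P` and
all `\overline{s_{l(u → u')} u}`, and its edges are `u → \overline{s_{l(u → u')} u}`, with label
`l(u → u')`, for `u → u'` in `^QE^P`. -/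
def toSubgraph (𝒟 : DoubleMomentGraph Φ Θ ΘQ ΘP) : LabelledGraph V where
  verts := doubleReps Θ ΘQ ΘP ∪
    {x | ∃ u u', doubleEdge Φ Θ ΘQ ΘP u u' ∧ x = bar Θ ΘP (refl (𝒟.label u u') * u)}
  edge x y α := ∃ u', doubleEdge Φ Θ ΘQ ΘP x u' ∧ α = 𝒟.label x u' ∧ y = bar Θ ΘP (refl α * x)

/-- The closure `⟨^Q𝒢^P⟩`: the `W_Q`-closure in `𝒢^P`. -/
def closure (𝒟 : DoubleMomentGraph Φ Θ ΘQ ΘP) : LabelledGraph V :=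
  hClosure Φ Θ ΘP (weyl ΘQ) (parabolicGraph Φ Θ ΘP) 𝒟.toSubgraph

/-- A double moment graph is closed if `⟨^Q𝒢^P⟩ = 𝒢^P`. -/
def IsClosed (𝒟 : DoubleMomentGraph Φ Θ ΘQ ΘP) : Prop :=
  𝒟.closure = parabolicGraph Φ Θ ΘP

end DoubleMomentGraph

end General

namespace TypeB

/-- The standard basis vector `e_i` of `ℝⁿ`. -/
def e {n : ℕ} (i : Fin n) : EuclideanSpace ℝ (Fin n) := EuclideanSpace.single i 1

/-- The root system of type `B_n`. -/
def roots (n : ℕ) : Set (EuclideanSpace ℝ (Fin n)) :=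
  {β | (∃ i j, i ≠ j ∧ (β = e i + e j ∨ β = -(e i + e j) ∨ β = e i - e j ∨ β = -(e i - e j))) ∨
    ∃ i, β = e i ∨ β = -e i}

/-- The simple roots `e_i - e_{i+1}` for `i < n` and `e_n` for `i = n`; the
indices here run from `0` to `n - 1`. -/
def simpleRoot {n : ℕ} (i : Fin n) : EuclideanSpace ℝ (Fin n) :=
  if h : (i : ℕ) + 1 < n then e i - e ⟨i + 1, h⟩ else e i

/-- The set `Θ` of simple roots. -/
def simpleRoots (n : ℕ) : Set (EuclideanSpace ℝ (Fin n)) := Set.range simpleRoot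

end TypeB

end DoubleMoment

end

/-! Choose dominant vectors `v` and `u` whose orthogonal simple roots are exactly `ΘP` and `ΘQ`.
Their stabilizers in `W` are `W_P` and `W_Q`, so `x ↦ x v` identifies `W^P` with the orbit `W v`,
and double cosets become `W_Q`-orbits on `W v`. An edge of `𝒢^P` at the point `x` is then a positive
root `α` with `⟪x, α⟫ > 0`, and it ends at `s_α x`. It stays in the `W_Q`-orbit of `x` iff `⟪u, α⟫ =
0`, and such edges always lie in the closure. If `⟪u, α⟫ > 0`, then `W_Q` keeps `α` positive, so
translates of chosen edges keep their direction. Hence the graph is closed iff any two edges that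
leave the same point and end in the same other `W_Q`-orbit are conjugate under the stabilizer of
that point in `W_Q` (`isClosed_iff_edgesConjugate`). The chosen labels no longer occur in this
criterion.

In type `B` the coordinates of a weight are nonnegative and weakly decreasing. The last simple root
belongs to the subset iff the last coordinate vanishes, and the subset is empty or a final segment
iff the nonzero coordinates are distinct (`injective_off_zero_iff`).

Necessity: if one of `u`, `v` has both zero and nonzero coordinates and the other has two equal
nonzero ones, then some short root `e_i` and long root `e_i + e_j` label edges from one point into
one orbit, and no isometry carries one root to the other.

Sufficiency: for final segments, `W_Q` fixes all coordinates where `u` is nonzero, and these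
determine the root up to conjugacy (`edgesConjugate_of_injective`). If `u` and `v` have no zero
coordinate, `W_Q` only permutes coordinates, and the multiset of pairs `(u_i, x_i)` determines it
(`edgesConjugate_of_ne_zero`). For full or empty subsets there are no edges to compare, or equal
reflections force equal roots. -/

namespace DoubleMoment

open scoped RealInnerProductSpace

/-! ### Weyl group combinatorics for an arbitrary root system with a base -/

section General

variable {V : Type*} [NormedAddCommGroup V] [InnerProductSpace ℝ V]

/-! ### Reflections -/

theorem refl_apply (α v : V) : refl α v = v - (2 * (⟪α, v⟫ / ‖α‖ ^ 2)) • α := by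
  rw [refl, Submodule.reflection_orthogonal_apply, Submodule.reflection_singleton_apply]
  simp only [RCLike.ofReal_real_eq_id, id_eq, neg_sub, two_smul, two_mul, add_smul]

theorem refl_self (α : V) : refl α α = -α :=
  Submodule.reflection_orthogonalComplement_singleton_eq_neg α

theorem refl_of_inner_eq_zero {α v : V} (h : ⟪v, α⟫ = 0) : refl α v = v := by
  rw [refl_apply, real_inner_comm, h]; simp

theorem refl_refl (α v : V) : refl α (refl α v) = v := Submodule.reflection_reflection _ v

@[simp] theorem refl_mul_self (α : V) : refl α * refl α = 1 := by
  ext v; simp [refl_refl]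

@[simp] theorem refl_inv (α : V) : (refl α)⁻¹ = refl α :=
  inv_eq_of_mul_eq_one_left (refl_mul_self α)

theorem refl_mul_refl_mul (α : V) (w : V ≃ₗᵢ[ℝ] V) : refl α * (refl α * w) = w := by
  rw [← mul_assoc, refl_mul_self, one_mul]

theorem refl_neg (α : V) : refl (-α) = refl α := by
  ext v; simp [refl_apply, neg_div, sub_eq_add_neg]

theorem mul_apply (a b : V ≃ₗᵢ[ℝ] V) (v : V) : (a * b) v = a (b v) := rfl

theorem inv_apply_apply (w : V ≃ₗᵢ[ℝ] V) (v : V) : w⁻¹ (w v) = v := by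
  rw [← mul_apply, inv_mul_cancel]; rfl

theorem apply_inv_apply (w : V ≃ₗᵢ[ℝ] V) (v : V) : w (w⁻¹ v) = v := by
  rw [← mul_apply, mul_inv_cancel]; rfl

theorem inner_apply_left (w : V ≃ₗᵢ[ℝ] V) (u v : V) : ⟪w u, v⟫ = ⟪u, w⁻¹ v⟫ := by
  rw [← LinearIsometryEquiv.inner_map_map w u, apply_inv_apply]

theorem inner_inv_apply_left (w : V ≃ₗᵢ[ℝ] V) (u v : V) : ⟪w⁻¹ u, v⟫ = ⟪u, w v⟫ := by
  rw [inner_apply_left, inv_inv]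

theorem refl_map (w : V ≃ₗᵢ[ℝ] V) (α : V) : refl (w α) = w * refl α * w⁻¹ := by
  ext v
  simp only [mul_apply, refl_apply, map_sub, map_smul, apply_inv_apply,
    LinearIsometryEquiv.norm_map]
  rw [inner_apply_left]

theorem refl_map_mul (w : V ≃ₗᵢ[ℝ] V) (α : V) : refl (w α) * w = w * refl α := by
  rw [refl_map, inv_mul_cancel_right]

theorem refl_apply_ne {α v : V} (h : ⟪v, α⟫ ≠ 0) : refl α v ≠ v := by
  intro h'
  have := inner_apply_left (refl α) v α
  rw [h', refl_inv, refl_self, inner_neg_right] at this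
  exact h (by linarith)

/-! ### Groups generated by reflections -/

theorem refl_mem_weyl {S : Set V} {α : V} (h : α ∈ S) : refl α ∈ weyl S :=
  Subgroup.subset_closure ⟨α, h, rfl⟩

theorem weyl_mono {S T : Set V} (h : S ⊆ T) : weyl S ≤ weyl T :=
  Subgroup.closure_mono (Set.image_mono h)

theorem weyl_empty : weyl (∅ : Set V) = ⊥ := by simp [weyl]

theorem weyl_induction {S : Set V} {p : (w : V ≃ₗᵢ[ℝ] V) → w ∈ weyl S → Prop}
    (one : p 1 (one_mem _))
    (mul : ∀ a, ∀ ha : a ∈ S, ∀ w, ∀ hw : w ∈ weyl S, p w hw →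
      p (refl a * w) (mul_mem (refl_mem_weyl ha) hw)) {w : V ≃ₗᵢ[ℝ] V} (hw : w ∈ weyl S) :
    p w hw := by
  induction hw using Subgroup.closure_induction_left with
  | one => exact one
  | mul_left x hx y hy ih => obtain ⟨a, ha, rfl⟩ := hx; exact mul a ha y hy ih
  | inv_mul_cancel x hx y hy ih =>
    obtain ⟨a, ha, rfl⟩ := hx
    simpa only [refl_inv] using mul a ha y hy ih

theorem exists_list_of_mem_weyl {S : Set V} {w : V ≃ₗᵢ[ℝ] V} (hw : w ∈ weyl S) :
    ∃ l : List V, (∀ α ∈ l, α ∈ S) ∧ (l.map refl).prod = w := by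
  induction hw using weyl_induction with
  | one => exact ⟨[], by simp, rfl⟩
  | mul a ha w _ ih =>
    obtain ⟨l, hl, rfl⟩ := ih
    exact ⟨a :: l, by simpa [ha] using hl, by simp⟩

theorem prod_mem_weyl {S : Set V} {l : List V} (hl : ∀ α ∈ l, α ∈ S) :
    (l.map refl).prod ∈ weyl S := by
  refine Subgroup.list_prod_mem _ fun x hx => ?_
  obtain ⟨a, ha, rfl⟩ := List.mem_map.1 hx
  exact refl_mem_weyl (hl a ha)

theorem apply_eq_self_of_mem_weyl {S : Set V} {v : V} (h : ∀ a ∈ S, ⟪v, a⟫ = 0)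
    {w : V ≃ₗᵢ[ℝ] V} (hw : w ∈ weyl S) : w v = v := by
  induction hw using weyl_induction with
  | one => rfl
  | mul a ha w _ ih => rw [mul_apply, ih, refl_of_inner_eq_zero (h a ha)]

/-! ### Length -/

theorem exists_list_length_eq {Θ : Set V} {w : V ≃ₗᵢ[ℝ] V} (hw : w ∈ weyl Θ) :
    ∃ l : List V, l.length = length Θ w ∧ (∀ α ∈ l, α ∈ Θ) ∧ (l.map refl).prod = w := by
  obtain ⟨l, hl, h⟩ := exists_list_of_mem_weyl hw
  exact Nat.sInf_mem
    (s := {k | ∃ l : List V, l.length = k ∧ (∀ α ∈ l, α ∈ Θ) ∧ (l.map refl).prod = w})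
    ⟨_, l, rfl, hl, h⟩

theorem length_prod_le {Θ : Set V} {l : List V} (hl : ∀ α ∈ l, α ∈ Θ) :
    length Θ (l.map refl).prod ≤ l.length :=
  Nat.sInf_le ⟨l, rfl, hl, rfl⟩

theorem length_le_of_bruhatLE {Φ Θ : Set V} {x y : V ≃ₗᵢ[ℝ] V} (h : bruhatLE Φ Θ x y) :
    length Θ x ≤ length Θ y := by
  induction h with
  | refl => exact le_rfl
  | tail _ h ih => obtain ⟨_, _, _, h⟩ := h; omega

/-! ### Weights -/

/-- A dominant vector whose orthogonal simple roots are exactly the elements of `S`. -/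
structure IsWeight (Θ S : Set V) (v : V) : Prop where
  inner_eq_zero : ∀ a ∈ S, ⟪v, a⟫ = 0
  inner_pos : ∀ a ∈ Θ, a ∉ S → 0 < ⟪v, a⟫

/-- The properties of a root system with a base on which the combinatorics of the Weyl group
rests. -/
structure IsRootBase (Φ Θ : Set V) : Prop where
  simple_mem : ∀ a ∈ Θ, a ∈ Φ
  neg_notMem : ∀ α ∈ posRoots Φ Θ, -α ∉ posRoots Φ Θ
  refl_mem : ∀ a ∈ Θ, ∀ β ∈ posRoots Φ Θ, β ≠ a → refl a β ∈ posRoots Φ Θ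
  refl_posRoot_mem : ∀ α ∈ posRoots Φ Θ, refl α ∈ weyl Θ
  reduced : ∀ α ∈ posRoots Φ Θ, ∀ β ∈ posRoots Φ Θ, ∀ t : ℝ, α = t • β → α = β
  exists_weight : ∀ S ⊆ Θ, ∃ v, IsWeight Θ S v

theorem IsWeight.inner_nonneg {Θ S : Set V} {v : V} (hv : IsWeight Θ S v) {a : V} (ha : a ∈ Θ) :
    0 ≤ ⟪v, a⟫ := by
  by_cases h : a ∈ S
  · rw [hv.inner_eq_zero a h]
  · exact (hv.inner_pos a ha h).le

theorem inner_nonneg_of_mem_closure {S : Set V} {v : V} (hv : ∀ a ∈ S, 0 ≤ ⟪v, a⟫) {γ : V}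
    (hγ : γ ∈ AddSubmonoid.closure S) : 0 ≤ ⟪v, γ⟫ := by
  induction hγ using AddSubmonoid.closure_induction with
  | mem x hx => exact hv x hx
  | zero => simp
  | add x y _ _ hx hy => rw [inner_add_right]; exact add_nonneg hx hy

/-- A sum of simple roots pairs with `v` as a sum of nonnegative terms, so a zero total forces every
summand to be orthogonal to `v`, that is, to lie in `S`. -/
theorem IsWeight.mem_closure {Θ S : Set V} {v : V} (hv : IsWeight Θ S v) {γ : V}
    (hγ : γ ∈ AddSubmonoid.closure Θ) (h0 : ⟪v, γ⟫ = 0) : γ ∈ AddSubmonoid.closure S := by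
  induction hγ using AddSubmonoid.closure_induction with
  | mem x hx =>
    by_cases h : x ∈ S
    · exact AddSubmonoid.subset_closure h
    · exact absurd h0 (hv.inner_pos x hx h).ne'
  | zero => exact zero_mem _
  | add x y hx hy ihx ihy =>
    have h1 := inner_nonneg_of_mem_closure (fun a ha => hv.inner_nonneg ha) hx
    have h2 := inner_nonneg_of_mem_closure (fun a ha => hv.inner_nonneg ha) hy
    rw [inner_add_right] at h0
    exact add_mem (ihx (by linarith)) (ihy (by linarith))

theorem IsWeight.inner_posRoot_nonneg {Φ Θ S : Set V} {v : V} (hv : IsWeight Θ S v) {α : V}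
    (hα : α ∈ posRoots Φ Θ) : 0 ≤ ⟪v, α⟫ :=
  inner_nonneg_of_mem_closure (fun _ ha => hv.inner_nonneg ha) hα.2

namespace IsRootBase

variable {Φ Θ ΘP ΘQ S : Set V} (hΦ : IsRootBase Φ Θ)
include hΦ

theorem simple_mem_posRoots {a : V} (ha : a ∈ Θ) : a ∈ posRoots Φ Θ :=
  ⟨hΦ.simple_mem a ha, AddSubmonoid.subset_closure ha⟩

theorem mem_or_neg_mem {w : V ≃ₗᵢ[ℝ] V} (hw : w ∈ weyl Θ) {α : V} (hα : α ∈ posRoots Φ Θ) :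
    w α ∈ posRoots Φ Θ ∨ -(w α) ∈ posRoots Φ Θ := by
  induction hw using weyl_induction with
  | one => exact Or.inl hα
  | mul a ha w _ ih =>
    have key : ∀ β ∈ posRoots Φ Θ, refl a β ∈ posRoots Φ Θ ∨ -(refl a β) ∈ posRoots Φ Θ := by
      intro β hβ
      by_cases h : β = a
      · right; rw [h, refl_self, neg_neg]; exact hΦ.simple_mem_posRoots ha
      · exact Or.inl (hΦ.refl_mem a ha β hβ h)
    rcases ih with h | h
    · exact key _ h
    · have := key _ h
      rw [map_neg, neg_neg] at this
      exact this.symm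

/-- The strong exchange property. -/
theorem exchange (hS : S ⊆ Θ) {l : List V} (hl : ∀ a ∈ l, a ∈ S) {α : V} (hα : α ∈ posRoots Φ Θ)
    (h : -((l.map refl).prod⁻¹ α) ∈ posRoots Φ Θ) :
    ∃ l' : List V, l'.length < l.length ∧ (∀ a ∈ l', a ∈ S) ∧
      (l'.map refl).prod = refl α * (l.map refl).prod := by
  induction l generalizing α with
  | nil => exact absurd h (hΦ.neg_notMem α hα)
  | cons a t ih =>
    have ha : a ∈ S := hl a (by simp)
    have ht : ∀ b ∈ t, b ∈ S := fun b hb => hl b (by simp [hb])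
    -- Follow `α` through the word: as long as it differs from the current letter, reflecting in
    -- that letter keeps it positive. It must become negative somewhere, and the letter it then
    -- equals is the one deleted.
    by_cases hαa : α = a
    · exact ⟨t, by simp, ht, by simp [hαa, refl_mul_refl_mul]⟩
    · obtain ⟨t', h1, h2, h3⟩ := ih ht (hΦ.refl_mem a (hS ha) α hα hαa)
        (by simpa [mul_inv_rev] using h)
      refine ⟨a :: t', by simpa using h1, by simpa [ha] using h2, ?_⟩
      rw [List.map_cons, List.prod_cons, h3, List.map_cons, List.prod_cons, ← mul_assoc,
        ← mul_assoc, refl_map, refl_inv]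
      simp only [← mul_assoc, refl_mul_self, one_mul]

theorem length_refl_mul_lt {x : V ≃ₗᵢ[ℝ] V} (hx : x ∈ weyl Θ) {α : V} (hα : α ∈ posRoots Φ Θ)
    (h : -(x⁻¹ α) ∈ posRoots Φ Θ) : length Θ (refl α * x) < length Θ x := by
  obtain ⟨l, h1, h2, rfl⟩ := exists_list_length_eq hx
  obtain ⟨l', h3, h4, h5⟩ := hΦ.exchange subset_rfl h2 hα h
  rw [← h5, ← h1]
  exact (length_prod_le h4).trans_lt h3

theorem lt_length_refl_mul {x : V ≃ₗᵢ[ℝ] V} (hx : x ∈ weyl Θ) {α : V} (hα : α ∈ posRoots Φ Θ)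
    (h : x⁻¹ α ∈ posRoots Φ Θ) : length Θ x < length Θ (refl α * x) := by
  have := hΦ.length_refl_mul_lt (mul_mem (hΦ.refl_posRoot_mem α hα) hx) hα
    (by simpa [mul_inv_rev, refl_self] using h)
  rwa [refl_mul_refl_mul] at this

/-- The sign of `x⁻¹ α` decides whether `s_α x` is longer or shorter than `x`, and lengths never
drop along the Bruhat order. -/
theorem bruhatLE_refl_mul_iff {x : V ≃ₗᵢ[ℝ] V} (hx : x ∈ weyl Θ) {α : V}
    (hα : α ∈ posRoots Φ Θ) : bruhatLE Φ Θ x (refl α * x) ↔ x⁻¹ α ∈ posRoots Φ Θ := by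
  constructor
  · intro h
    refine (hΦ.mem_or_neg_mem (inv_mem hx) hα).resolve_right fun h' => ?_
    exact (hΦ.length_refl_mul_lt hx hα h').not_ge (length_le_of_bruhatLE h)
  · intro h
    exact Relation.ReflTransGen.single ⟨α, hα, rfl, hΦ.lt_length_refl_mul hx hα h⟩

/-- If `v` and `x⁻¹ v` are both dominant for `S`, then `x` is in the stabilizer of `v`, which is
generated by simple reflections. -/
theorem mem_weyl_of_dominant (hS : S ⊆ Θ) {x : V ≃ₗᵢ[ℝ] V} (hx : x ∈ weyl S) {v : V}
    (hv : ∀ a ∈ S, 0 ≤ ⟪v, a⟫) (hxv : ∀ a ∈ S, 0 ≤ ⟪x⁻¹ v, a⟫) :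
    x ∈ weyl {a | a ∈ S ∧ ⟪v, a⟫ = 0} := by
  obtain ⟨l, hl, h⟩ := exists_list_of_mem_weyl hx
  induction hk : l.length using Nat.strong_induction_on generalizing l x with
  | _ k ih =>
  match l, hl with
  | [], _ => rw [← h]; exact one_mem _
  | a :: t, hl =>
    have ha : a ∈ S := hl a (by simp)
    have ht : ∀ b ∈ t, b ∈ S := fun b hb => hl b (by simp [hb])
    have hxt : x = refl a * (t.map refl).prod := by simpa using h.symm
    have haΦ := hΦ.simple_mem_posRoots (hS ha)
    rcases hΦ.mem_or_neg_mem (weyl_mono hS (inv_mem hx)) haΦ with hpos | hneg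
    -- Here the word is not reduced: exchange in its tail yields a shorter word for the same `x`.
    · obtain ⟨l', h3, h4, h5⟩ := hΦ.exchange hS ht haΦ
        (by simpa [hxt, mul_inv_rev, refl_self] using hpos)
      exact ih l'.length (by simp at hk; omega) hx hxv l' h4 (by rw [h5, hxt]) rfl
    -- Now `-(x⁻¹ a)` is positive, and a weight of `S`, being fixed by `x`, shows that it is a sum
    -- of elements of `S`. Dominance of `x⁻¹ v` then gives `⟪v, a⟫ ≤ 0`, so `a` fixes `v` and can be
    -- split off.
    · obtain ⟨w, hw⟩ := hΦ.exists_weight S hS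
      have hcl : -(x⁻¹ a) ∈ AddSubmonoid.closure S := by
        refine hw.mem_closure hneg.2 ?_
        rw [inner_neg_right, ← inner_apply_left,
          apply_eq_self_of_mem_weyl hw.inner_eq_zero hx, hw.inner_eq_zero a ha, neg_zero]
      have h1 := inner_nonneg_of_mem_closure hxv hcl
      rw [inner_neg_right, LinearIsometryEquiv.inner_map_map] at h1
      have h0 : ⟪v, a⟫ = 0 := le_antisymm (by linarith) (hv a ha)
      have hy := ih t.length (by simp at hk; omega) (prod_mem_weyl ht) (by
        intro b hb
        have := hxv b hb
        rwa [hxt, mul_inv_rev, refl_inv, mul_apply,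
          refl_of_inner_eq_zero h0] at this) t ht rfl rfl
      rw [hxt]
      exact mul_mem (refl_mem_weyl ⟨ha, h0⟩) hy

theorem apply_weight_eq_iff {v : V} (hv : IsWeight Θ S v) {w : V ≃ₗᵢ[ℝ] V}
    (hw : w ∈ weyl Θ) : w v = v ↔ w ∈ weyl S := by
  refine ⟨fun h => ?_, apply_eq_self_of_mem_weyl hv.inner_eq_zero⟩
  have h' : w⁻¹ v = v := by rw [← h, inv_apply_apply, h]
  refine weyl_mono ?_ (hΦ.mem_weyl_of_dominant subset_rfl hw (fun a ha => hv.inner_nonneg ha)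
    (by rw [h']; exact fun a ha => hv.inner_nonneg ha))
  rintro a ⟨ha, h0⟩
  by_contra hS'
  exact (hv.inner_pos a ha hS').ne' h0

/-! ### Representatives of cosets -/

omit hΦ in
theorem doubleReps_subset_leftReps : doubleReps Θ ΘQ ΘP ⊆ leftReps Θ ΘP := by
  rintro x ⟨hx, h⟩
  refine ⟨hx, ?_⟩
  rintro y ⟨a, ha, b, hb, rfl⟩
  exact h _ ⟨a, weyl_mono (Set.empty_subset _) ha, b, hb, rfl⟩

theorem apply_mem_of_mem_doubleReps (hP : ΘP ⊆ Θ) {x : V ≃ₗᵢ[ℝ] V}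
    (hx : x ∈ doubleReps Θ ΘQ ΘP) {a : V} (ha : a ∈ ΘP) : x a ∈ posRoots Φ Θ := by
  have haΦ := hΦ.simple_mem_posRoots (hP ha)
  refine (hΦ.mem_or_neg_mem hx.1 haΦ).resolve_right fun h => ?_
  have h1 := hΦ.length_refl_mul_lt hx.1 h (by rwa [map_neg, neg_neg, inv_apply_apply])
  rw [refl_neg, refl_map_mul] at h1
  exact h1.not_ge (hx.2 _ ⟨1, one_mem _, _, refl_mem_weyl ha, by rw [one_mul]⟩)

theorem inv_apply_mem_of_mem_doubleReps (hQ : ΘQ ⊆ Θ) {x : V ≃ₗᵢ[ℝ] V}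
    (hx : x ∈ doubleReps Θ ΘQ ΘP) {a : V} (ha : a ∈ ΘQ) : x⁻¹ a ∈ posRoots Φ Θ := by
  have haΦ := hΦ.simple_mem_posRoots (hQ ha)
  refine (hΦ.mem_or_neg_mem (inv_mem hx.1) haΦ).resolve_right fun h => ?_
  exact (hΦ.length_refl_mul_lt hx.1 haΦ h).not_ge
    (hx.2 _ ⟨_, refl_mem_weyl ha, 1, one_mem _, by rw [mul_one]⟩)

/-- For `ρ` strictly positive on all positive roots, `x⁻¹ ρ` and `y⁻¹ ρ` are strictly dominant for
`ΘP` and differ by `x⁻¹ y ∈ W_P`. The stabilizer of a strictly dominant vector is trivial. -/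
theorem leftReps_unique (hP : ΘP ⊆ Θ) {x y : V ≃ₗᵢ[ℝ] V} (hx : x ∈ leftReps Θ ΘP)
    (hy : y ∈ leftReps Θ ΘP) (h : x⁻¹ * y ∈ weyl ΘP) : x = y := by
  obtain ⟨ρ, hρ⟩ := hΦ.exists_weight ∅ (Set.empty_subset _)
  have hpos : ∀ γ ∈ posRoots Φ Θ, 0 < ⟪ρ, γ⟫ := by
    intro γ hγ
    refine (hρ.inner_posRoot_nonneg hγ).lt_of_ne' fun h0 => hΦ.neg_notMem γ hγ ?_
    have := hρ.mem_closure hγ.2 h0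
    rw [AddSubmonoid.closure_empty, AddSubmonoid.mem_bot] at this
    subst this
    simpa using hγ
  have hdom : ∀ z ∈ leftReps Θ ΘP, ∀ a ∈ ΘP, 0 < ⟪z⁻¹ ρ, a⟫ := by
    intro z hz a ha
    rw [inner_inv_apply_left]
    exact hpos _ (hΦ.apply_mem_of_mem_doubleReps hP hz ha)
  have h1 := hΦ.mem_weyl_of_dominant hP h (v := x⁻¹ ρ) (fun a ha => (hdom x hx a ha).le)
    (by simpa [mul_inv_rev, apply_inv_apply] using fun a ha => (hdom y hy a ha).le)
  have h2 : {a | a ∈ ΘP ∧ ⟪x⁻¹ ρ, a⟫ = 0} = ∅ :=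
    Set.eq_empty_of_forall_notMem fun a ha => (hdom x hx a ha.1).ne' ha.2
  rw [h2, weyl_empty, Subgroup.mem_bot] at h1
  exact inv_mul_eq_one.1 h1

variable {v : V}

theorem leftReps_eq_of_apply_eq (hP : ΘP ⊆ Θ) (hv : IsWeight Θ ΘP v) {x y : V ≃ₗᵢ[ℝ] V}
    (hx : x ∈ leftReps Θ ΘP) (hy : y ∈ leftReps Θ ΘP) (h : x v = y v) : x = y := by
  refine hΦ.leftReps_unique hP hx hy
    ((hΦ.apply_weight_eq_iff hv (mul_mem (inv_mem hx.1) hy.1)).1 ?_)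
  rw [mul_apply, ← h, inv_apply_apply]

/-- Minimal double coset representatives send `v` to `ΘQ`-dominant points, and a `W_Q`-orbit
contains only one such point. -/
theorem doubleReps_apply_eq (hP : ΘP ⊆ Θ) (hQ : ΘQ ⊆ Θ) (hv : IsWeight Θ ΘP v)
    {x y : V ≃ₗᵢ[ℝ] V} (hx : x ∈ doubleReps Θ ΘQ ΘP) (hy : y ∈ doubleReps Θ ΘQ ΘP)
    {c : V ≃ₗᵢ[ℝ] V} (hc : c ∈ weyl ΘQ) (h : c (x v) = y v) : x = y ∧ c (x v) = x v := by
  have hdom : ∀ z ∈ doubleReps Θ ΘQ ΘP, ∀ a ∈ ΘQ, 0 ≤ ⟪z v, a⟫ := by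
    intro z hz a ha
    rw [inner_apply_left]
    exact hv.inner_posRoot_nonneg (hΦ.inv_apply_mem_of_mem_doubleReps hQ hz ha)
  have h1 := hΦ.mem_weyl_of_dominant hQ (inv_mem hc) (hdom x hx)
    (by rw [inv_inv, h]; exact hdom y hy)
  have h2 : c (x v) = x v := apply_eq_self_of_mem_weyl (fun a ha => ha.2) (inv_mem_iff.1 h1)
  exact ⟨hΦ.leftReps_eq_of_apply_eq hP hv (doubleReps_subset_leftReps hx)
    (doubleReps_subset_leftReps hy) (h2.symm.trans h), h2⟩

omit hΦ in
theorem hat_mem_doubleCoset (w : V ≃ₗᵢ[ℝ] V) : hat Θ ΘQ ΘP w ∈ doubleCoset ΘQ ΘP w :=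
  Function.argminOn_mem _ _ _

omit hΦ in
theorem hat_mem (hP : ΘP ⊆ Θ) (hQ : ΘQ ⊆ Θ) {w : V ≃ₗᵢ[ℝ] V} (hw : w ∈ weyl Θ) :
    hat Θ ΘQ ΘP w ∈ doubleReps Θ ΘQ ΘP := by
  obtain ⟨a, ha, b, hb, h⟩ := hat_mem_doubleCoset (Θ := Θ) (ΘQ := ΘQ) (ΘP := ΘP) w
  refine ⟨h ▸ mul_mem (mul_mem (weyl_mono hQ ha) hw) (weyl_mono hP hb), ?_⟩
  rintro y ⟨c, hc, d, hd, rfl⟩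
  have hmem : c * hat Θ ΘQ ΘP w * d ∈ doubleCoset ΘQ ΘP w :=
    ⟨c * a, mul_mem hc ha, b * d, mul_mem hb hd, by rw [h]; simp only [mul_assoc]⟩
  exact Function.argminOn_le _ _ hmem

omit hΦ in
theorem exists_apply_hat_eq (hv : IsWeight Θ ΘP v) (w : V ≃ₗᵢ[ℝ] V) :
    ∃ c ∈ weyl ΘQ, c (hat Θ ΘQ ΘP w v) = w v := by
  obtain ⟨a, ha, b, hb, h⟩ := hat_mem_doubleCoset (Θ := Θ) (ΘQ := ΘQ) (ΘP := ΘP) w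
  refine ⟨a⁻¹, inv_mem ha, ?_⟩
  rw [h, mul_assoc, mul_apply, inv_apply_apply, mul_apply,
    apply_eq_self_of_mem_weyl hv.inner_eq_zero hb]

theorem hat_eq_iff (hP : ΘP ⊆ Θ) (hQ : ΘQ ⊆ Θ) (hv : IsWeight Θ ΘP v) {x y : V ≃ₗᵢ[ℝ] V}
    (hx : x ∈ weyl Θ) (hy : y ∈ weyl Θ) :
    hat Θ ΘQ ΘP x = hat Θ ΘQ ΘP y ↔ ∃ c ∈ weyl ΘQ, c (x v) = y v := by
  obtain ⟨a, ha, hax⟩ := exists_apply_hat_eq (ΘQ := ΘQ) hv x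
  obtain ⟨b, hb, hby⟩ := exists_apply_hat_eq (ΘQ := ΘQ) hv y
  constructor
  · intro h
    refine ⟨b * a⁻¹, mul_mem hb (inv_mem ha), ?_⟩
    rw [← hax, mul_apply, inv_apply_apply, h, hby]
  · rintro ⟨c, hc, h⟩
    refine (hΦ.doubleReps_apply_eq hP hQ hv (hat_mem hP hQ hx) (hat_mem hP hQ hy)
      (c := b⁻¹ * c * a) (mul_mem (mul_mem (inv_mem hb) hc) ha) ?_).1
    rw [mul_apply, mul_apply, hax, h, ← hby,
      inv_apply_apply]

theorem hat_eq_self (hP : ΘP ⊆ Θ) (hQ : ΘQ ⊆ Θ) {x : V ≃ₗᵢ[ℝ] V}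
    (hx : x ∈ doubleReps Θ ΘQ ΘP) : hat Θ ΘQ ΘP x = x := by
  obtain ⟨v, hv⟩ := hΦ.exists_weight ΘP hP
  obtain ⟨a, ha, hax⟩ := exists_apply_hat_eq (ΘQ := ΘQ) hv x
  exact (hΦ.doubleReps_apply_eq hP hQ hv (hat_mem hP hQ hx.1) hx ha hax).1

omit hΦ in
theorem bar_mem (hP : ΘP ⊆ Θ) {w : V ≃ₗᵢ[ℝ] V} (hw : w ∈ weyl Θ) :
    bar Θ ΘP w ∈ leftReps Θ ΘP :=
  hat_mem hP (Set.empty_subset _) hw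

omit hΦ in
theorem bar_apply (hv : IsWeight Θ ΘP v) (w : V ≃ₗᵢ[ℝ] V) : bar Θ ΘP w v = w v := by
  obtain ⟨c, hc, h⟩ := exists_apply_hat_eq (ΘQ := ∅) hv w
  rw [weyl_empty, Subgroup.mem_bot] at hc
  rwa [hc] at h

theorem eq_bar_iff (hP : ΘP ⊆ Θ) (hv : IsWeight Θ ΘP v) {x y : V ≃ₗᵢ[ℝ] V}
    (hx : x ∈ leftReps Θ ΘP) (hy : y ∈ weyl Θ) : x = bar Θ ΘP y ↔ x v = y v := by
  rw [← bar_apply hv y]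
  exact ⟨fun h => h ▸ rfl, hΦ.leftReps_eq_of_apply_eq hP hv hx (bar_mem hP hy)⟩

/-! ### Edges -/

/-- By the length criterion, going up means that `x⁻¹ α` is positive, hence `⟪x v, α⟫ ≥ 0`. The
point moves exactly when this pairing is nonzero. -/
theorem bruhatLE_and_ne_iff (hv : IsWeight Θ ΘP v) {x : V ≃ₗᵢ[ℝ] V}
    (hx : x ∈ weyl Θ) {α : V} (hα : α ∈ posRoots Φ Θ) :
    bruhatLE Φ Θ x (refl α * x) ∧ x v ≠ refl α (x v) ↔ 0 < ⟪x v, α⟫ := by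
  rw [hΦ.bruhatLE_refl_mul_iff hx hα, inner_apply_left]
  constructor
  · rintro ⟨h1, h2⟩
    refine (hv.inner_posRoot_nonneg h1).lt_of_ne' fun h0 => h2 ?_
    rw [refl_of_inner_eq_zero]
    rwa [inner_apply_left]
  · intro h
    refine ⟨(hΦ.mem_or_neg_mem (inv_mem hx) hα).resolve_right fun h' => ?_, ?_⟩
    · have := hv.inner_posRoot_nonneg h'
      rw [inner_neg_right] at this
      linarith
    · rw [← inner_apply_left] at h
      exact (refl_apply_ne h.ne').symm

theorem parabolicGraph_edge_iff (hP : ΘP ⊆ Θ) (hv : IsWeight Θ ΘP v) {x y : V ≃ₗᵢ[ℝ] V} {α : V} :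
    (parabolicGraph Φ Θ ΘP).edge x y α ↔ x ∈ leftReps Θ ΘP ∧ y ∈ leftReps Θ ΘP ∧
      α ∈ posRoots Φ Θ ∧ 0 < ⟪x v, α⟫ ∧ y v = refl α (x v) := by
  have key : x ∈ leftReps Θ ΘP → α ∈ posRoots Φ Θ →
      (bar Θ ΘP x ≠ bar Θ ΘP (refl α * x) ↔ x v ≠ refl α (x v)) := by
    intro hx hα
    rw [Ne, hΦ.eq_bar_iff hP hv (bar_mem hP hx.1) (mul_mem (hΦ.refl_posRoot_mem α hα) hx.1),
      bar_apply hv]; rfl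
  constructor
  · rintro ⟨hx, hα, h1, h2, rfl⟩
    have hsx := mul_mem (hΦ.refl_posRoot_mem α hα) hx.1
    exact ⟨hx, bar_mem hP hsx, hα,
      (hΦ.bruhatLE_and_ne_iff hv hx.1 hα).1 ⟨h1, (key hx hα).1 h2⟩, bar_apply hv _⟩
  · rintro ⟨hx, hy, hα, h1, h2⟩
    obtain ⟨h3, h4⟩ := (hΦ.bruhatLE_and_ne_iff hv hx.1 hα).2 h1
    exact ⟨hx, hα, h3, (key hx hα).2 h4,
      (hΦ.eq_bar_iff hP hv hy (mul_mem (hΦ.refl_posRoot_mem α hα) hx.1)).2 h2⟩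

end IsRootBase

end General

/-! ### Closedness as conjugacy of edges -/

section Criterion

variable {V : Type*} [NormedAddCommGroup V] [InnerProductSpace ℝ V]

/-- The condition that any two edges of `𝒢^P` that leave the same vertex and end in the
same `W_Q`-orbit, different from the one in which they start, are conjugate under the stabilizer
of the vertex in `W_Q`. Vertices are the points of the `W`-orbit of the weight `v` of `Θ_P`, and `u`
is a weight of `Θ_Q`. -/
def EdgesConjugate (Φ Θ ΘQ : Set V) (v u : V) : Prop :=
  ∀ w ∈ weyl Θ, ∀ α ∈ posRoots Φ Θ, ∀ β ∈ posRoots Φ Θ, 0 < ⟪w v, α⟫ → 0 < ⟪w v, β⟫ →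
    0 < ⟪u, α⟫ → 0 < ⟪u, β⟫ → (∃ c ∈ weyl ΘQ, c (refl α (w v)) = refl β (w v)) →
    ∃ c ∈ weyl ΘQ, c (w v) = w v ∧ c α = β

theorem eq_smul_of_refl_eq {α β x : V} (hα : ⟪x, α⟫ ≠ 0) (h : refl α x = refl β x) :
    ∃ t : ℝ, α = t • β ∧ ⟪x, α⟫ = t * ⟪x, β⟫ := by
  have hα0 : ‖α‖ ≠ 0 := by
    intro h0
    rw [norm_eq_zero] at h0
    exact hα (by rw [h0, inner_zero_right])
  rw [refl_apply, refl_apply, sub_right_inj] at h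
  have hc : 2 * (⟪α, x⟫ / ‖α‖ ^ 2) ≠ 0 := by
    rw [real_inner_comm]; positivity
  refine ⟨(2 * (⟪α, x⟫ / ‖α‖ ^ 2))⁻¹ * (2 * (⟪β, x⟫ / ‖β‖ ^ 2)), ?_⟩
  have h1 : α = ((2 * (⟪α, x⟫ / ‖α‖ ^ 2))⁻¹ * (2 * (⟪β, x⟫ / ‖β‖ ^ 2))) • β := by
    rw [mul_smul, ← h, smul_smul, inv_mul_cancel₀ hc, one_smul]
  refine ⟨h1, ?_⟩
  conv_lhs => rw [h1]
  rw [inner_smul_right]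

namespace IsRootBase

variable {Φ Θ ΘP ΘQ : Set V} (hΦ : IsRootBase Φ Θ) {v u : V}

theorem inner_weight_apply (hu : IsWeight Θ ΘQ u) {c : V ≃ₗᵢ[ℝ] V} (hc : c ∈ weyl ΘQ) (α : V) :
    ⟪u, c α⟫ = ⟪u, α⟫ := by
  rw [← inner_inv_apply_left, apply_eq_self_of_mem_weyl hu.inner_eq_zero (inv_mem hc)]

section
include hΦ

theorem apply_mem_of_inner_weight_pos (hQ : ΘQ ⊆ Θ) (hu : IsWeight Θ ΘQ u) {c : V ≃ₗᵢ[ℝ] V}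
    (hc : c ∈ weyl ΘQ) {α : V} (hα : α ∈ posRoots Φ Θ) (h : 0 < ⟪u, α⟫) :
    c α ∈ posRoots Φ Θ := by
  refine (hΦ.mem_or_neg_mem (weyl_mono hQ hc) hα).resolve_right fun h' => ?_
  have := hu.inner_posRoot_nonneg h'
  rw [inner_neg_right, inner_weight_apply hu hc] at this
  linarith

/-- All of `W_Q` fixes `u`, so `⟪u, ·⟫` is constant on its orbits, whereas `s_α` changes `⟪u, x⟫` by
a nonzero multiple of `⟪u, α⟫`. If `⟪u, α⟫ = 0`, then `s_α` itself belongs to `W_Q`. -/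
theorem inner_weight_pos_iff (hu : IsWeight Θ ΘQ u) {x α : V}
    (hα : α ∈ posRoots Φ Θ) (hx : ⟪x, α⟫ ≠ 0) :
    0 < ⟪u, α⟫ ↔ ¬ ∃ c ∈ weyl ΘQ, c x = refl α x := by
  constructor
  · rintro h ⟨c, hc, hcx⟩
    have h1 : ⟪u, refl α x⟫ = ⟪u, x⟫ := by rw [← hcx, inner_weight_apply hu hc]
    rw [refl_apply, inner_sub_right, inner_smul_right, sub_eq_self, real_inner_comm] at h1
    have hα0 : ‖α‖ ≠ 0 := by
      intro h0
      rw [norm_eq_zero] at h0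
      exact hx (by rw [h0, inner_zero_right])
    have h2 := h.ne'
    have : 2 * (⟪x, α⟫ / ‖α‖ ^ 2) * ⟪u, α⟫ ≠ 0 := by positivity
    exact this h1
  · intro h
    refine (hu.inner_posRoot_nonneg hα).lt_of_ne' fun h0 => h ⟨refl α, ?_, rfl⟩
    exact (hΦ.apply_weight_eq_iff hu (hΦ.refl_posRoot_mem α hα)).1 (refl_of_inner_eq_zero h0)

theorem doubleEdge_hat (hP : ΘP ⊆ Θ) (hQ : ΘQ ⊆ Θ) (hv : IsWeight Θ ΘP v) (hu : IsWeight Θ ΘQ u)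
    {x : V ≃ₗᵢ[ℝ] V} (hx : x ∈ doubleReps Θ ΘQ ΘP) {β : V} (hβ : β ∈ posRoots Φ Θ)
    (h1 : 0 < ⟪x v, β⟫) (h2 : 0 < ⟪u, β⟫) :
    doubleEdge Φ Θ ΘQ ΘP x (hat Θ ΘQ ΘP (refl β * x)) := by
  refine ⟨hx, ⟨β, hβ, rfl, ((hΦ.bruhatLE_and_ne_iff hv hx.1 hβ).2 h1).1⟩, fun h => ?_⟩
  refine (hΦ.inner_weight_pos_iff hu hβ h1.ne').1 h2 ?_
  exact (hΦ.hat_eq_iff hP hQ hv hx.1 (mul_mem (hΦ.refl_posRoot_mem β hβ) hx.1)).1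
    ((hΦ.hat_eq_self hP hQ hx).trans h)

theorem inner_pos_of_mem_admissibleLabels (hP : ΘP ⊆ Θ) (hQ : ΘQ ⊆ Θ) (hv : IsWeight Θ ΘP v)
    (hu : IsWeight Θ ΘQ u) {x y : V ≃ₗᵢ[ℝ] V} (hx : x ∈ doubleReps Θ ΘQ ΘP) (hxy : x ≠ y) {β : V}
    (hβ : β ∈ admissibleLabels Φ Θ ΘQ ΘP x y) : 0 < ⟪x v, β⟫ ∧ 0 < ⟪u, β⟫ := by
  obtain ⟨hβ, rfl, h⟩ := hβ
  have hne : ¬ ∃ c ∈ weyl ΘQ, c (x v) = refl β (x v) := by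
    intro h'
    refine hxy ?_
    conv_lhs => rw [← hΦ.hat_eq_self hP hQ hx]
    exact (hΦ.hat_eq_iff hP hQ hv hx.1 (mul_mem (hΦ.refl_posRoot_mem β hβ) hx.1)).2 h'
  have h1 := (hΦ.bruhatLE_and_ne_iff hv hx.1 hβ).1 ⟨h, fun h' => hne ⟨1, one_mem _, h'⟩⟩
  exact ⟨h1, (hΦ.inner_weight_pos_iff hu hβ h1.ne').2 hne⟩

end

section
include hΦ
variable (hP : ΘP ⊆ Θ) (hQ : ΘQ ⊆ Θ) (hv : IsWeight Θ ΘP v) (hu : IsWeight Θ ΘQ u)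
  (𝒟 : DoubleMomentGraph Φ Θ ΘQ ΘP)
include hP hQ hv hu

theorem toSubgraph_edge_iff {x y : V ≃ₗᵢ[ℝ] V} {α : V} :
    𝒟.toSubgraph.edge x y α ↔ x ∈ doubleReps Θ ΘQ ΘP ∧ y ∈ leftReps Θ ΘP ∧ α ∈ posRoots Φ Θ ∧
      0 < ⟪x v, α⟫ ∧ 0 < ⟪u, α⟫ ∧ y v = refl α (x v) ∧
      α = 𝒟.label x (hat Θ ΘQ ΘP (refl α * x)) := by
  constructor
  · rintro ⟨x', hx', rfl, rfl⟩
    have hl := 𝒟.label_mem _ _ hx'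
    obtain ⟨h1, h2⟩ := hΦ.inner_pos_of_mem_admissibleLabels hP hQ hv hu hx'.1 hx'.2.2 hl
    exact ⟨hx'.1, bar_mem hP (mul_mem (hΦ.refl_posRoot_mem _ hl.1) hx'.1.1), hl.1, h1, h2,
      bar_apply hv _, by rw [← hl.2.1]⟩
  · rintro ⟨hx, hy, hα, h1, h2, h3, h4⟩
    exact ⟨_, hΦ.doubleEdge_hat hP hQ hv hu hx hα h1 h2, h4,
      (hΦ.eq_bar_iff hP hv hy (mul_mem (hΦ.refl_posRoot_mem α hα) hx.1)).2 h3⟩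

omit hQ hv hu in
theorem toSubgraph_verts_subset : 𝒟.toSubgraph.verts ⊆ leftReps Θ ΘP := by
  rintro x (hx | ⟨y, y', h, rfl⟩)
  · exact doubleReps_subset_leftReps hx
  · exact bar_mem hP (mul_mem (hΦ.refl_posRoot_mem _ (𝒟.label_mem _ _ h).1) h.1.1)

omit hu in
theorem eq_bar_mul_hat {x : V ≃ₗᵢ[ℝ] V} (hx : x ∈ leftReps Θ ΘP) :
    ∃ c ∈ weyl ΘQ, x = bar Θ ΘP (c * hat Θ ΘQ ΘP x) ∧ c (hat Θ ΘQ ΘP x v) = x v := by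
  obtain ⟨c, hc, h⟩ := exists_apply_hat_eq (ΘQ := ΘQ) (Θ := Θ) hv x
  exact ⟨c, hc, (hΦ.eq_bar_iff hP hv hx
    (mul_mem (weyl_mono hQ hc) (hat_mem hP hQ hx.1).1)).2 h.symm, h⟩

omit hu in
theorem closure_verts : 𝒟.closure.verts = leftReps Θ ΘP := by
  ext x
  constructor
  · rintro ⟨c, hc, y, hy, rfl⟩
    exact bar_mem hP (mul_mem (weyl_mono hQ hc)
      (hΦ.toSubgraph_verts_subset hP 𝒟 hy).1)
  · intro hx
    obtain ⟨c, hc, h, -⟩ := hΦ.eq_bar_mul_hat hP hQ hv hx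
    exact ⟨c, hc, _, Or.inl (hat_mem hP hQ hx.1), h⟩

/-- The translate of an edge of `𝒢'` is an edge of `𝒢^P` with the translated label, in the same
direction. -/
theorem parabolicGraph_edge_of_toSubgraph_edge {a b : V ≃ₗᵢ[ℝ] V} {α : V}
    (h : 𝒟.toSubgraph.edge a b α) {c : V ≃ₗᵢ[ℝ] V} (hc : c ∈ weyl ΘQ) :
    (parabolicGraph Φ Θ ΘP).edge (bar Θ ΘP (c * a)) (bar Θ ΘP (c * b)) (c α) := by
  obtain ⟨ha, hb, hα, h1, h2, h3, -⟩ := (hΦ.toSubgraph_edge_iff hP hQ hv hu 𝒟).1 h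
  refine (hΦ.parabolicGraph_edge_iff hP hv).2 ⟨bar_mem hP (mul_mem (weyl_mono hQ hc) ha.1),
    bar_mem hP (mul_mem (weyl_mono hQ hc) hb.1),
    hΦ.apply_mem_of_inner_weight_pos hQ hu hc hα h2, ?_, ?_⟩
  · rwa [bar_apply hv, mul_apply, LinearIsometryEquiv.inner_map_map]
  · rw [bar_apply hv, bar_apply hv, mul_apply, mul_apply, h3, ← mul_apply, ← refl_map_mul]; rfl

/-- Reversed edges disappear, because `W_Q` keeps the labels of `𝒢'` positive. The condition on
edges inside an orbit loses its reference to `𝒢'`, because every orbit contains a double coset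
representative. -/
theorem closure_edge_iff {x y : V ≃ₗᵢ[ℝ] V} {γ : V} : 𝒟.closure.edge x y γ ↔
    ((parabolicGraph Φ Θ ΘP).edge x y γ ∧ ∃ c ∈ weyl ΘQ, c (x v) = y v) ∨
    ∃ a b α, 𝒟.toSubgraph.edge a b α ∧ ∃ c ∈ weyl ΘQ,
      x = bar Θ ΘP (c * a) ∧ y = bar Θ ΘP (c * b) ∧ γ = c α := by
  constructor
  · rintro (⟨h, z, hz, c, hc, d, hd, rfl, rfl⟩ | ⟨a, b, α, h, c, hc, -, h1, h2, h3⟩ |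
      ⟨a, b, α, h, c, hc, hneg, -⟩)
    · refine Or.inl ⟨h, d * c⁻¹, mul_mem hd (inv_mem hc), ?_⟩
      rw [bar_apply hv, bar_apply hv, mul_apply, mul_apply, mul_apply, inv_apply_apply]
    · exact Or.inr ⟨a, b, α, h, c, hc, h1, h2, h3⟩
    · obtain ⟨-, -, hα, -, h2, -⟩ := (hΦ.toSubgraph_edge_iff hP hQ hv hu 𝒟).1 h
      exact absurd hneg (hΦ.neg_notMem _ (hΦ.apply_mem_of_inner_weight_pos hQ hu hc hα h2))
  · rintro (⟨h, d, hd, hxy⟩ | ⟨a, b, α, h, c, hc, rfl, rfl, rfl⟩)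
    · obtain ⟨hx, hy, -⟩ := (hΦ.parabolicGraph_edge_iff hP hv).1 h
      obtain ⟨c, hc, h1, h2⟩ := hΦ.eq_bar_mul_hat hP hQ hv hx
      refine Or.inl ⟨h, _, Or.inl (hat_mem hP hQ hx.1), c, hc, d * c, mul_mem hd hc, h1, ?_⟩
      refine (hΦ.eq_bar_iff hP hv hy
        (mul_mem (weyl_mono hQ (mul_mem hd hc)) (hat_mem hP hQ hx.1).1)).2 ?_
      rw [mul_apply, mul_apply, h2, hxy]
    · refine Or.inr (Or.inl ⟨a, b, α, h, c, hc, ?_, rfl, rfl, rfl⟩)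
      exact ((hΦ.parabolicGraph_edge_iff hP hv).1
        (hΦ.parabolicGraph_edge_of_toSubgraph_edge hP hQ hv hu 𝒟 h hc)).2.2.1

/-- In a closed double moment graph every admissible label is conjugate to the chosen one. -/
theorem exists_apply_label_eq (h𝒟 : 𝒟.IsClosed) {x : V ≃ₗᵢ[ℝ] V}
    (hx : x ∈ doubleReps Θ ΘQ ΘP) {β : V} (hβ : β ∈ posRoots Φ Θ) (h1 : 0 < ⟪x v, β⟫)
    (h2 : 0 < ⟪u, β⟫) : ∃ c ∈ weyl ΘQ, c (x v) = x v ∧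
      c (𝒟.label x (hat Θ ΘQ ΘP (refl β * x))) = β := by
  have hs := mul_mem (hΦ.refl_posRoot_mem β hβ) hx.1
  have hedge : (parabolicGraph Φ Θ ΘP).edge x (bar Θ ΘP (refl β * x)) β :=
    (hΦ.parabolicGraph_edge_iff hP hv).2
      ⟨doubleReps_subset_leftReps hx, bar_mem hP hs, hβ, h1, bar_apply hv _⟩
  rw [← h𝒟, hΦ.closure_edge_iff hP hQ hv hu 𝒟] at hedge
  -- The edge leaves its `W_Q`-orbit, so it is a translate by some `c` of a chosen edge. Both
  -- sources are double coset representatives, so they agree and `c` fixes the point.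
  rcases hedge with ⟨-, h⟩ | ⟨a, b, α, h, c, hc, hxa, hyb, rfl⟩
  · rw [bar_apply hv] at h
    exact absurd h ((hΦ.inner_weight_pos_iff hu hβ h1.ne').1 h2)
  · obtain ⟨ha, hb, hα, h3, h4, h5, h6⟩ := (hΦ.toSubgraph_edge_iff hP hQ hv hu 𝒟).1 h
    have hca : c (a v) = x v := by
      rw [hxa, bar_apply hv]; rfl
    obtain ⟨rfl, h7⟩ := hΦ.doubleReps_apply_eq hP hQ hv ha hx hc hca
    refine ⟨c, hc, h7, ?_⟩
    have h8 : hat Θ ΘQ ΘP (refl α * a) = hat Θ ΘQ ΘP (refl (c α) * a) := by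
      refine (hΦ.hat_eq_iff hP hQ hv (mul_mem (hΦ.refl_posRoot_mem α hα) ha.1) hs).2 ⟨c, hc, ?_⟩
      rw [mul_apply, mul_apply, refl_map, mul_apply, mul_apply]
      congr 2
      conv_rhs => rw [← h7, inv_apply_apply]
    rw [← h8, ← h6]

/-- Any edge leaving its `W_Q`-orbit can be moved by `W_Q` to start at a double coset
representative. There, closedness means that its label is conjugate, under the stabilizer of the
point, to the single label chosen for its target orbit. -/
theorem isClosed_iff_edgesConjugate : 𝒟.IsClosed ↔ EdgesConjugate Φ Θ ΘQ v u := by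
  constructor
  · intro h w hw α hα β hβ h1 h2 h3 h4 ⟨d, hd, hαβ⟩
    obtain ⟨c, hc, hcw⟩ := exists_apply_hat_eq (ΘQ := ΘQ) (Θ := Θ) hv w
    have hx := hat_mem (ΘQ := ΘQ) hP hQ hw
    set x := hat Θ ΘQ ΘP w
    have key : ∀ γ ∈ posRoots Φ Θ, 0 < ⟪w v, γ⟫ → 0 < ⟪u, γ⟫ → c⁻¹ γ ∈ posRoots Φ Θ ∧
        ∃ b ∈ weyl ΘQ, b (x v) = x v ∧
          b (𝒟.label x (hat Θ ΘQ ΘP (refl (c⁻¹ γ) * x))) = c⁻¹ γ := by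
      intro γ hγ h1 h2
      have h3 := hΦ.apply_mem_of_inner_weight_pos hQ hu (inv_mem hc) hγ h2
      refine ⟨h3, hΦ.exists_apply_label_eq hP hQ hv hu 𝒟 h hx h3 ?_ ?_⟩
      · rwa [← inner_apply_left, hcw]
      · rwa [inner_weight_apply hu (inv_mem hc)]
    obtain ⟨hα', a, ha, ha1, ha2⟩ := key α hα h1 h3
    obtain ⟨hβ', b, hb, hb1, hb2⟩ := key β hβ h2 h4
    have hpt : ∀ γ, refl (c⁻¹ γ) (x v) = c⁻¹ (refl γ (w v)) := by
      intro γ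
      rw [refl_map, mul_apply, mul_apply, inv_inv, hcw]
    have hhat : hat Θ ΘQ ΘP (refl (c⁻¹ α) * x) = hat Θ ΘQ ΘP (refl (c⁻¹ β) * x) := by
      refine (hΦ.hat_eq_iff hP hQ hv (mul_mem (hΦ.refl_posRoot_mem _ hα') hx.1)
        (mul_mem (hΦ.refl_posRoot_mem _ hβ') hx.1)).2
        ⟨c⁻¹ * d * c, mul_mem (mul_mem (inv_mem hc) hd) hc, ?_⟩
      rw [mul_apply, mul_apply, mul_apply, mul_apply, hpt, hpt, apply_inv_apply, hαβ]
    have hinv : ∀ {g : V ≃ₗᵢ[ℝ] V} {y z : V}, g y = z → g⁻¹ z = y := by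
      rintro g y _ rfl; exact inv_apply_apply g y
    -- Move to the representative by `c⁻¹`, pass from `c⁻¹ α` to the common chosen label by `a⁻¹`
    -- and on to `c⁻¹ β` by `b`, then return by `c`.
    refine ⟨c * b * a⁻¹ * c⁻¹,
      mul_mem (mul_mem (mul_mem hc hb) (inv_mem ha)) (inv_mem hc), ?_, ?_⟩
    · rw [mul_apply, mul_apply, mul_apply, hinv hcw, hinv ha1, hb1, hcw]
    · rw [mul_apply, mul_apply, mul_apply, hinv ha2, hhat, hb2, apply_inv_apply]
  · intro h
    refine LabelledGraph.ext (hΦ.closure_verts hP hQ hv 𝒟) ?_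
    ext x y γ
    rw [hΦ.closure_edge_iff hP hQ hv hu 𝒟]
    constructor
    · rintro (⟨h, -⟩ | ⟨a, b, α, h, c, hc, rfl, rfl, rfl⟩)
      · exact h
      · exact hΦ.parabolicGraph_edge_of_toSubgraph_edge hP hQ hv hu 𝒟 h hc
    · intro hxy
      obtain ⟨hx, hy, hγ, h1, h2⟩ := (hΦ.parabolicGraph_edge_iff hP hv).1 hxy
      by_cases hcr : ∃ c ∈ weyl ΘQ, c (x v) = refl γ (x v)
      · rw [← h2] at hcr
        exact Or.inl ⟨hxy, hcr⟩
      right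
      have h3 := (hΦ.inner_weight_pos_iff hu hγ h1.ne').2 hcr
      obtain ⟨c, hc, hxa, hca⟩ := hΦ.eq_bar_mul_hat hP hQ hv hx
      have ha := hat_mem (ΘQ := ΘQ) hP hQ hx.1
      set a := hat Θ ΘQ ΘP x
      have hγ' := hΦ.apply_mem_of_inner_weight_pos hQ hu (inv_mem hc) hγ h3
      have h4 : 0 < ⟪a v, c⁻¹ γ⟫ := by rwa [← inner_apply_left, hca]
      have h5 : 0 < ⟪u, c⁻¹ γ⟫ := by rwa [inner_weight_apply hu (inv_mem hc)]
      have hde := hΦ.doubleEdge_hat hP hQ hv hu ha hγ' h4 h5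
      have hl := 𝒟.label_mem _ _ hde
      set α := 𝒟.label a (hat Θ ΘQ ΘP (refl (c⁻¹ γ) * a))
      obtain ⟨h6, h7⟩ := hΦ.inner_pos_of_mem_admissibleLabels hP hQ hv hu ha hde.2.2 hl
      have hα := mul_mem (hΦ.refl_posRoot_mem _ hl.1) ha.1
      obtain ⟨d, hd, hd1, hd2⟩ := h a ha.1 α hl.1 _ hγ' h6 h4 h7 h5
        ((hΦ.hat_eq_iff hP hQ hv hα (mul_mem (hΦ.refl_posRoot_mem _ hγ') ha.1)).1 hl.2.1.symm)
      have hγd : γ = (c * d) α := by rw [mul_apply, hd2, apply_inv_apply]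
      have hcd := mul_mem hc hd
      have hcda : (c * d) (a v) = x v := by rw [mul_apply, hd1, hca]
      refine ⟨a, bar Θ ΘP (refl α * a), α, ⟨_, hde, rfl, rfl⟩, c * d, hcd, ?_, ?_, hγd⟩
      · exact (hΦ.eq_bar_iff hP hv hx (mul_mem (weyl_mono hQ hcd) ha.1)).2 hcda.symm
      · refine (hΦ.eq_bar_iff hP hv hy
          (mul_mem (weyl_mono hQ hcd) (bar_mem hP hα).1)).2 ?_
        rw [h2, hγd, mul_apply (c * d), bar_apply hv, mul_apply (refl α), refl_map,
          mul_apply _ (c * d)⁻¹, ← hcda, inv_apply_apply]; rfl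

end

/-! ### Cases in which all edges are conjugate -/

theorem inner_posRoot_eq_zero (hv : IsWeight Θ Θ v) {α : V} (hα : α ∈ posRoots Φ Θ) :
    ⟪v, α⟫ = 0 := by
  have h1 := inner_nonneg_of_mem_closure (v := v) (fun a ha => (hv.inner_eq_zero a ha).ge) hα.2
  have h2 := inner_nonneg_of_mem_closure (v := -v)
    (fun a ha => by rw [inner_neg_left, hv.inner_eq_zero a ha, neg_zero]) hα.2
  rw [inner_neg_left] at h2
  linarith

theorem edgesConjugate_of_left_eq (hv : IsWeight Θ Θ v) : EdgesConjugate Φ Θ ΘQ v u := by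
  intro w hw α hα β _ h1
  rw [apply_eq_self_of_mem_weyl hv.inner_eq_zero hw, inner_posRoot_eq_zero hv hα] at h1
  exact absurd h1 (lt_irrefl _)

theorem edgesConjugate_of_right_eq (hu : IsWeight Θ Θ u) : EdgesConjugate Φ Θ ΘQ v u := by
  intro w _ α hα β _ _ _ h1
  rw [inner_posRoot_eq_zero hu hα] at h1
  exact absurd h1 (lt_irrefl _)

include hΦ

theorem edgesConjugate_of_right_empty : EdgesConjugate Φ Θ ∅ v u := by
  rintro w _ α hα β hβ h1 _ _ _ ⟨c, hc, h⟩
  obtain rfl : c = 1 := by simpa [weyl_empty] using hc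
  obtain ⟨t, ht, -⟩ := eq_smul_of_refl_eq h1.ne' h
  exact ⟨1, hc, rfl, hΦ.reduced α hα β hβ t ht⟩

/-- The weight `v` has trivial stabilizer, so agreement on `w v` gives `c * refl α = refl β` in the
group. Applying inverses to `u`, which `c` fixes, gives `s_α u = s_β u`, so the roots are
proportional. -/
theorem edgesConjugate_of_left_empty (hv : IsWeight Θ ∅ v) (hQ : ΘQ ⊆ Θ) (hu : IsWeight Θ ΘQ u) :
    EdgesConjugate Φ Θ ΘQ v u := by
  rintro w hw α hα β hβ _ _ h1 _ ⟨c, hc, h⟩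
  have h2 : (refl β * w)⁻¹ * (c * refl α * w) ∈ weyl (∅ : Set V) := by
    refine (hΦ.apply_weight_eq_iff hv (mul_mem (inv_mem (mul_mem (hΦ.refl_posRoot_mem β hβ) hw))
      (mul_mem (mul_mem (weyl_mono hQ hc) (hΦ.refl_posRoot_mem α hα)) hw))).1 ?_
    rw [mul_apply, mul_apply (c * _), mul_apply c, h, ← mul_apply (refl β), inv_apply_apply]
  rw [weyl_empty, Subgroup.mem_bot, inv_mul_eq_one, mul_left_inj] at h2
  have h3 : refl α u = refl β u := by
    rw [← refl_inv β, h2, mul_inv_rev, refl_inv, mul_apply,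
      apply_eq_self_of_mem_weyl hu.inner_eq_zero (inv_mem hc)]
  obtain ⟨t, ht, -⟩ := eq_smul_of_refl_eq h1.ne' h3
  obtain rfl := hΦ.reduced α hα β hβ t ht
  exact ⟨1, one_mem _, rfl, rfl⟩

end IsRootBase

end Criterion

/-! ### Type `B` in coordinates -/

namespace TypeB

variable {n : ℕ}

theorem e_apply (i j : Fin n) : (e i : EuclideanSpace ℝ (Fin n)) j = if j = i then 1 else 0 := by
  simp [e]

theorem inner_e (v : EuclideanSpace ℝ (Fin n)) (i : Fin n) : ⟪v, e i⟫ = v i := by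
  simp [e, EuclideanSpace.inner_single_right]

theorem inner_e_left (v : EuclideanSpace ℝ (Fin n)) (i : Fin n) : ⟪e i, v⟫ = v i := by
  rw [real_inner_comm, inner_e]

/-! ### Reflections in coordinates -/

theorem refl_e_apply (i k : Fin n) (v : EuclideanSpace ℝ (Fin n)) :
    refl (e i) v k = if k = i then -v i else v k := by
  have h : ‖(e i : EuclideanSpace ℝ (Fin n))‖ = 1 := by simp [e]
  rw [refl_apply, inner_e_left, h]
  simp only [PiLp.sub_apply, PiLp.smul_apply, e_apply, smul_eq_mul]
  split_ifs with hk
  · subst hk; ring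
  · ring

theorem refl_e_sub_e_apply {i j : Fin n} (hij : i ≠ j) (k : Fin n)
    (v : EuclideanSpace ℝ (Fin n)) : refl (e i - e j) v k = v (Equiv.swap i j k) := by
  have h : ‖(e i - e j : EuclideanSpace ℝ (Fin n))‖ ^ 2 = 2 := by
    rw [← real_inner_self_eq_norm_sq, inner_sub_left, inner_e_left, inner_e_left]
    simp [e_apply, hij, hij.symm]; norm_num
  rw [refl_apply, inner_sub_left, inner_e_left, inner_e_left, h]
  simp only [PiLp.sub_apply, PiLp.smul_apply, e_apply, smul_eq_mul, Equiv.swap_apply_def]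
  split_ifs with h1 h2 h2
  · exact absurd (h1.symm.trans h2) hij
  · subst h1; ring
  · subst h2; ring
  · ring

theorem refl_e_add_e_apply {i j : Fin n} (hij : i ≠ j) (k : Fin n)
    (v : EuclideanSpace ℝ (Fin n)) :
    refl (e i + e j) v k = if k = i ∨ k = j then -v (Equiv.swap i j k) else v k := by
  have h : ‖(e i + e j : EuclideanSpace ℝ (Fin n))‖ ^ 2 = 2 := by
    rw [← real_inner_self_eq_norm_sq, inner_add_left, inner_e_left, inner_e_left]
    simp [e_apply, hij, hij.symm]; norm_num
  rw [refl_apply, inner_add_left, inner_e_left, inner_e_left, h]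
  simp only [PiLp.sub_apply, PiLp.add_apply, PiLp.smul_apply, e_apply, smul_eq_mul,
    Equiv.swap_apply_def]
  by_cases h1 : k = i
  · subst h1; simp [hij]; ring
  · by_cases h2 : k = j
    · subst h2; simp [h1]; ring
    · simp [h1, h2]

theorem refl_e_e (i k : Fin n) : refl (e i) (e k) = if k = i then -e k else e k := by
  ext l
  rw [refl_e_apply]
  split_ifs with h1 h2 h2
  · subst h1 h2; simp
  · subst h1; simp [e_apply, Ne.symm h2]
  · subst h2; simp [e_apply, h1]
  · rfl

theorem refl_e_sub_e_e {i j : Fin n} (hij : i ≠ j) (k : Fin n) :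
    refl (e i - e j) (e k) = e (Equiv.swap i j k) := by
  ext l
  rw [refl_e_sub_e_apply hij, e_apply, e_apply]
  congr 1
  rw [eq_iff_iff, Equiv.swap_apply_eq_iff]

theorem refl_e_add_e_e {i j : Fin n} (hij : i ≠ j) : refl (e i + e j) (e i) = -e j := by
  ext l
  rw [refl_e_add_e_apply hij, PiLp.neg_apply, e_apply, e_apply, e_apply]
  by_cases h1 : l = i
  · subst h1; simp [hij, hij.symm]
  · by_cases h2 : l = j
    · subst h2; simp
    · simp [h1, h2]

/-! ### The root system with its base -/

theorem simpleRoot_of_lt {i : Fin n} (h : (i : ℕ) + 1 < n) :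
    simpleRoot i = e i - e ⟨i + 1, h⟩ := dif_pos h

theorem simpleRoot_of_eq {i : Fin n} (h : (i : ℕ) + 1 = n) : simpleRoot i = e i :=
  dif_neg (by omega)

theorem simpleRoot_mem (i : Fin n) : simpleRoot i ∈ simpleRoots n := ⟨i, rfl⟩

theorem simpleRoot_mem_roots (i : Fin n) : simpleRoot i ∈ roots n := by
  by_cases h : (i : ℕ) + 1 < n
  · rw [simpleRoot_of_lt h]
    exact Or.inl ⟨i, ⟨i + 1, h⟩, by simp [Fin.ext_iff], by simp⟩
  · rw [simpleRoot_of_eq (by omega)]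
    exact Or.inr ⟨i, by simp⟩

theorem e_sub_e_mem_closure {i j : Fin n} (hij : i ≤ j) :
    (e i - e j : EuclideanSpace ℝ (Fin n)) ∈ AddSubmonoid.closure (simpleRoots n) := by
  obtain ⟨k, hk⟩ := Nat.exists_eq_add_of_le (Fin.le_def.1 hij)
  induction k generalizing i with
  | zero =>
    obtain rfl : j = i := Fin.ext (by omega)
    rw [sub_self]; exact zero_mem _
  | succ k ih =>
    have h : (i : ℕ) + 1 < n := by omega
    have := add_mem (AddSubmonoid.subset_closure (simpleRoot_mem i))
      (ih (i := ⟨i + 1, h⟩) (by rw [Fin.le_def]; simp; omega) (by simp; omega))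
    rwa [simpleRoot_of_lt h, sub_add_sub_cancel] at this

theorem e_mem_closure (i : Fin n) :
    (e i : EuclideanSpace ℝ (Fin n)) ∈ AddSubmonoid.closure (simpleRoots n) := by
  have hn : n - 1 < n := by have := i.2; omega
  have h1 := e_sub_e_mem_closure (i := i) (j := ⟨n - 1, hn⟩) (by rw [Fin.le_def]; simp; omega)
  have h2 : e ⟨n - 1, hn⟩ ∈ AddSubmonoid.closure (simpleRoots n) := by
    rw [← simpleRoot_of_eq (i := ⟨n - 1, hn⟩) (by simp; omega)]
    exact AddSubmonoid.subset_closure (simpleRoot_mem _)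
  have := add_mem h1 h2
  rwa [sub_add_cancel] at this

theorem inner_simpleRoot (v : EuclideanSpace ℝ (Fin n)) (i : Fin n) :
    ⟪v, simpleRoot i⟫ = v i - if h : (i : ℕ) + 1 < n then v ⟨i + 1, h⟩ else 0 := by
  split_ifs with h
  · rw [simpleRoot_of_lt h, inner_sub_right, inner_e, inner_e]
  · rw [simpleRoot_of_eq (by omega), inner_e, sub_zero]

/-- The sum of the fundamental coweights of the simple roots outside of `S`. -/
noncomputable def weight (S : Set (EuclideanSpace ℝ (Fin n))) : EuclideanSpace ℝ (Fin n) :=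
  open scoped Classical in
  WithLp.toLp 2 fun i => ∑ t, if i ≤ t ∧ simpleRoot t ∉ S then 1 else 0

open scoped Classical in
theorem inner_weight_simpleRoot (S : Set (EuclideanSpace ℝ (Fin n))) (i : Fin n) :
    ⟪weight S, simpleRoot i⟫ = if simpleRoot i ∈ S then 0 else 1 := by
  -- Split off the term `t = i`. The remaining sum over `i < t` is the next coordinate, or is empty
  -- when `i` is the last index.
  have key : weight S i = (if simpleRoot i ∈ S then 0 else 1) +
      ∑ t, if i < t ∧ simpleRoot t ∉ S then (1 : ℝ) else 0 := by
    have h1 : ∀ t, (if i ≤ t ∧ simpleRoot t ∉ S then (1 : ℝ) else 0) =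
        (if t = i then if simpleRoot i ∈ S then 0 else 1 else 0) +
          if i < t ∧ simpleRoot t ∉ S then (1 : ℝ) else 0 := by
      intro t
      rcases lt_trichotomy i t with h | rfl | h
      · simp [h, h.le, h.ne']
      · simp
      · simp [h.not_ge, h.not_gt, h.ne]
    change (∑ t, if i ≤ t ∧ simpleRoot t ∉ S then (1 : ℝ) else 0) = _
    simp only [h1, Finset.sum_add_distrib, Finset.sum_ite_eq', Finset.mem_univ, if_true]
  rw [inner_simpleRoot, key, add_sub_assoc, add_eq_left, sub_eq_zero]
  split_ifs with h
  · refine Finset.sum_congr rfl fun t _ => ?_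
    have : i < t ↔ (⟨i + 1, h⟩ : Fin n) ≤ t := by rw [Fin.lt_def, Fin.le_def]; rfl
    simp only [this]
  · refine Finset.sum_eq_zero fun t _ => if_neg ?_
    rintro ⟨h', -⟩
    rw [Fin.lt_def] at h'
    omega

theorem isWeight_weight {S : Set (EuclideanSpace ℝ (Fin n))} (hS : S ⊆ simpleRoots n) :
    IsWeight (simpleRoots n) S (weight S) := by
  classical
  constructor
  · intro a ha
    obtain ⟨i, rfl⟩ := hS ha
    rw [inner_weight_simpleRoot, if_pos ha]
  · rintro _ ⟨i, rfl⟩ hi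
    rw [inner_weight_simpleRoot, if_neg hi]; exact one_pos

theorem mem_posRoots_iff {β : EuclideanSpace ℝ (Fin n)} :
    β ∈ posRoots (roots n) (simpleRoots n) ↔
      (∃ i j, i < j ∧ (β = e i + e j ∨ β = e i - e j)) ∨ ∃ i, β = e i := by
  constructor
  · rintro ⟨hβ, hcl⟩
    -- The vector `(n, n - 1, …, 1)` is nonnegative on sums of simple roots, and its sign on each
    -- root rules out the negative ones.
    let ρ : EuclideanSpace ℝ (Fin n) := WithLp.toLp 2 fun i => (n : ℝ) - i
    have hpos : ∀ i, 0 < ρ i := fun i => sub_pos.2 (Nat.cast_lt.2 i.2)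
    have hanti : ∀ i j, i < j → ρ j < ρ i := fun i j h =>
      sub_lt_sub_left (Nat.cast_lt.2 (Fin.lt_def.1 h)) _
    have hρ : 0 ≤ ⟪ρ, β⟫ := by
      refine inner_nonneg_of_mem_closure ?_ hcl
      rintro _ ⟨i, rfl⟩
      rw [inner_simpleRoot]
      split_ifs with h
      · exact sub_nonneg.2 (hanti _ _ (by rw [Fin.lt_def]; simp)).le
      · rw [sub_zero]; exact (hpos i).le
    rcases hβ with ⟨i, j, hij, rfl | rfl | rfl | rfl⟩ | ⟨i, rfl | rfl⟩
    · rcases hij.lt_or_gt with h | h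
      · exact Or.inl ⟨i, j, h, Or.inl rfl⟩
      · exact Or.inl ⟨j, i, h, Or.inl (add_comm _ _)⟩
    · rw [inner_neg_right, inner_add_right, inner_e, inner_e] at hρ
      linarith [hpos i, hpos j]
    · rw [inner_sub_right, inner_e, inner_e] at hρ
      rcases hij.lt_or_gt with h | h
      · exact Or.inl ⟨i, j, h, Or.inr rfl⟩
      · linarith [hanti j i h]
    · rw [inner_neg_right, inner_sub_right, inner_e, inner_e] at hρ
      rcases hij.lt_or_gt with h | h
      · linarith [hanti i j h]
      · exact Or.inl ⟨j, i, h, Or.inr (neg_sub _ _)⟩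
    · exact Or.inr ⟨i, rfl⟩
    · rw [inner_neg_right, inner_e] at hρ
      linarith [hpos i]
  · rintro (⟨i, j, hij, rfl | rfl⟩ | ⟨i, rfl⟩)
    · exact ⟨Or.inl ⟨i, j, hij.ne, by simp⟩, add_mem (e_mem_closure i) (e_mem_closure j)⟩
    · exact ⟨Or.inl ⟨i, j, hij.ne, by simp⟩, e_sub_e_mem_closure hij.le⟩
    · exact ⟨Or.inr ⟨i, by simp⟩, e_mem_closure i⟩

theorem e_mem_posRoots (i : Fin n) : e i ∈ posRoots (roots n) (simpleRoots n) :=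
  mem_posRoots_iff.2 (Or.inr ⟨i, rfl⟩)

theorem e_sub_e_mem_posRoots {i j : Fin n} (h : i < j) :
    e i - e j ∈ posRoots (roots n) (simpleRoots n) :=
  mem_posRoots_iff.2 (Or.inl ⟨i, j, h, Or.inr rfl⟩)

theorem e_add_e_mem_posRoots {i j : Fin n} (h : i ≠ j) :
    e i + e j ∈ posRoots (roots n) (simpleRoots n) := by
  rcases h.lt_or_gt with h | h
  · exact mem_posRoots_iff.2 (Or.inl ⟨i, j, h, Or.inl rfl⟩)
  · exact mem_posRoots_iff.2 (Or.inl ⟨j, i, h, Or.inl (add_comm _ _)⟩)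

theorem neg_notMem_posRoots {α : EuclideanSpace ℝ (Fin n)}
    (h : α ∈ posRoots (roots n) (simpleRoots n)) : -α ∉ posRoots (roots n) (simpleRoots n) := by
  have key : ∀ β ∈ posRoots (roots n) (simpleRoots n),
      0 < ⟪(WithLp.toLp 2 fun i => (n : ℝ) - i : EuclideanSpace ℝ (Fin n)), β⟫ := by
    intro β hβ
    have hpos : ∀ i : Fin n, 0 < (n : ℝ) - i := fun i => sub_pos.2 (Nat.cast_lt.2 i.2)
    rcases mem_posRoots_iff.1 hβ with ⟨i, j, hij, rfl | rfl⟩ | ⟨i, rfl⟩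
    · rw [inner_add_right, inner_e, inner_e]; exact add_pos (hpos i) (hpos j)
    · rw [inner_sub_right, inner_e, inner_e]
      exact sub_pos.2 (sub_lt_sub_left (Nat.cast_lt.2 (Fin.lt_def.1 hij)) _)
    · rw [inner_e]; exact hpos i
  intro h'
  have h1 := key _ h
  have h2 := key _ h'
  rw [inner_neg_right] at h2
  linarith

theorem refl_e_sub_e_mem_weyl {i j : Fin n} (hij : i < j) :
    refl (e i - e j : EuclideanSpace ℝ (Fin n)) ∈ weyl (simpleRoots n) := by
  obtain ⟨k, hk⟩ := Nat.exists_eq_add_of_lt (Fin.lt_def.1 hij)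
  induction k generalizing i with
  | zero =>
    have h : (i : ℕ) + 1 < n := by omega
    obtain rfl : j = ⟨i + 1, h⟩ := Fin.ext (by simp; omega)
    rw [← simpleRoot_of_lt h]
    exact refl_mem_weyl (simpleRoot_mem i)
  | succ k ih =>
    have h : (i : ℕ) + 1 < n := by omega
    have h1 := ih (i := ⟨i + 1, h⟩) (by rw [Fin.lt_def]; simp; omega) (by simp; omega)
    have h2 := refl_mem_weyl (simpleRoot_mem i)
    have h3 : (e i - e j : EuclideanSpace ℝ (Fin n)) =
        refl (simpleRoot i) (e ⟨i + 1, h⟩ - e j) := by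
      have hne : i ≠ ⟨i + 1, h⟩ := by simp [Fin.ext_iff]
      rw [simpleRoot_of_lt h, map_sub, refl_e_sub_e_e hne, refl_e_sub_e_e hne,
        Equiv.swap_apply_right, Equiv.swap_apply_of_ne_of_ne hij.ne' (by
          intro h'; rw [h'] at hk; simp at hk)]
    rw [h3, refl_map]
    exact mul_mem (mul_mem h2 h1) (inv_mem h2)

theorem refl_e_mem_weyl (i : Fin n) :
    refl (e i : EuclideanSpace ℝ (Fin n)) ∈ weyl (simpleRoots n) := by
  have hn : n - 1 < n := by have := i.2; omega
  have h1 : refl (e ⟨n - 1, hn⟩) ∈ weyl (simpleRoots n) := by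
    rw [← simpleRoot_of_eq (i := ⟨n - 1, hn⟩) (by simp; omega)]
    exact refl_mem_weyl (simpleRoot_mem _)
  rcases (show i ≤ ⟨n - 1, hn⟩ by rw [Fin.le_def]; simp; omega).eq_or_lt with rfl | h
  · exact h1
  · have h2 := refl_e_sub_e_mem_weyl h
    rw [← Equiv.swap_apply_right i ⟨n - 1, hn⟩, ← refl_e_sub_e_e h.ne, refl_map]
    exact mul_mem (mul_mem h2 h1) (inv_mem h2)

theorem refl_mem_weyl_of_mem_posRoots {α : EuclideanSpace ℝ (Fin n)}
    (h : α ∈ posRoots (roots n) (simpleRoots n)) : refl α ∈ weyl (simpleRoots n) := by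
  rcases mem_posRoots_iff.1 h with ⟨i, j, hij, rfl | rfl⟩ | ⟨i, rfl⟩
  · have h1 : (e i + e j : EuclideanSpace ℝ (Fin n)) = refl (e j) (e i - e j) := by
      rw [map_sub, refl_e_e, refl_e_e, if_neg hij.ne, if_pos rfl, sub_neg_eq_add]
    rw [h1, refl_map]
    exact mul_mem (mul_mem (refl_e_mem_weyl j) (refl_e_sub_e_mem_weyl hij))
      (inv_mem (refl_e_mem_weyl j))
  · exact refl_e_sub_e_mem_weyl hij
  · exact refl_e_mem_weyl i

theorem refl_simpleRoot_mem (k : Fin n) {β : EuclideanSpace ℝ (Fin n)}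
    (h : β ∈ posRoots (roots n) (simpleRoots n)) (hne : β ≠ simpleRoot k) :
    refl (simpleRoot k) β ∈ posRoots (roots n) (simpleRoots n) := by
  by_cases hk : (k : ℕ) + 1 < n
  · have hkk : k ≠ ⟨k + 1, hk⟩ := by simp [Fin.ext_iff]
    rw [simpleRoot_of_lt hk] at hne ⊢
    rcases mem_posRoots_iff.1 h with ⟨i, j, hij, rfl | rfl⟩ | ⟨i, rfl⟩
    · rw [map_add, refl_e_sub_e_e hkk, refl_e_sub_e_e hkk]
      exact e_add_e_mem_posRoots ((Equiv.injective _).ne hij.ne)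
    · rw [map_sub, refl_e_sub_e_e hkk, refl_e_sub_e_e hkk]
      refine e_sub_e_mem_posRoots ?_
      have : ¬ (i = k ∧ j = ⟨k + 1, hk⟩) := by rintro ⟨rfl, rfl⟩; exact hne rfl
      rw [Equiv.swap_apply_def, Equiv.swap_apply_def]
      split_ifs <;> simp only [Fin.lt_def, Fin.ext_iff] at * <;> omega
    · rw [refl_e_sub_e_e hkk]
      exact e_mem_posRoots _
  · rw [simpleRoot_of_eq (by omega)] at hne ⊢
    rcases mem_posRoots_iff.1 h with ⟨i, j, hij, rfl | rfl⟩ | ⟨i, rfl⟩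
    · have hik : i ≠ k := by rintro rfl; rw [Fin.lt_def] at hij; omega
      rw [map_add, refl_e_e, refl_e_e, if_neg hik]
      split_ifs
      · rw [← sub_eq_add_neg]; exact e_sub_e_mem_posRoots hij
      · exact h
    · have hik : i ≠ k := by rintro rfl; rw [Fin.lt_def] at hij; omega
      rw [map_sub, refl_e_e, refl_e_e, if_neg hik]
      split_ifs
      · rw [sub_neg_eq_add]; exact e_add_e_mem_posRoots hij.ne
      · exact h
    · rw [refl_e_e, if_neg (by rintro rfl; exact hne rfl)]
      exact h

theorem eq_of_eq_smul {α β : EuclideanSpace ℝ (Fin n)}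
    (hα : α ∈ posRoots (roots n) (simpleRoots n)) (hβ : β ∈ posRoots (roots n) (simpleRoots n))
    {t : ℝ} (h : α = t • β) : α = β := by
  have h1 : ∃ i, α i = 1 := by
    rcases mem_posRoots_iff.1 hα with ⟨i, j, hij, rfl | rfl⟩ | ⟨i, rfl⟩
    · exact ⟨i, by simp [e_apply, hij.ne]⟩
    · exact ⟨i, by simp [e_apply, hij.ne]⟩
    · exact ⟨i, by simp [e_apply]⟩
  have h2 : ∀ i, β i = 1 ∨ β i = 0 ∨ β i = -1 := by
    intro k
    rcases mem_posRoots_iff.1 hβ with ⟨i, j, hij, rfl | rfl⟩ | ⟨i, rfl⟩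
    · have : ¬ (k = i ∧ k = j) := by rintro ⟨rfl, rfl⟩; exact hij.ne rfl
      simp only [PiLp.add_apply, e_apply]; split_ifs <;> simp_all
    · simp only [PiLp.sub_apply, e_apply]; split_ifs <;> simp
    · rw [e_apply]; split_ifs <;> simp
  obtain ⟨i, hi⟩ := h1
  rw [h, PiLp.smul_apply, smul_eq_mul] at hi
  rcases h2 i with h2 | h2 | h2 <;> rw [h2] at hi
  · rw [h, (mul_one t).symm.trans hi, one_smul]
  · simp at hi
  · rw [show t = -1 by linarith, neg_one_smul] at h
    exact absurd (h ▸ hα) (neg_notMem_posRoots hβ)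

theorem isRootBase (n : ℕ) : IsRootBase (roots n) (simpleRoots n) where
  simple_mem := by rintro _ ⟨i, rfl⟩; exact simpleRoot_mem_roots i
  neg_notMem _ h := neg_notMem_posRoots h
  refl_mem := by rintro _ ⟨k, rfl⟩ β hβ hne; exact refl_simpleRoot_mem k hβ hne
  refl_posRoot_mem _ h := refl_mem_weyl_of_mem_posRoots h
  reduced _ hα _ hβ _ h := eq_of_eq_smul hα hβ h
  exists_weight S hS := ⟨weight S, isWeight_weight hS⟩

/-! ### Weyl group elements in coordinates -/

/-- Only the last simple reflection changes a sign. Recording this makes parabolic subgroups without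
it act by pure permutations. -/
theorem refl_simpleRoot_apply (k : Fin n) : ∃ σ : Equiv.Perm (Fin n),
    ∀ (x : EuclideanSpace ℝ (Fin n)) (i : Fin n), (refl (simpleRoot k) x i = x (σ i) ∨
      ((k : ℕ) + 1 = n ∧ refl (simpleRoot k) x i = -x (σ i))) := by
  by_cases hk : (k : ℕ) + 1 < n
  · refine ⟨Equiv.swap k ⟨k + 1, hk⟩, fun x i => Or.inl ?_⟩
    rw [simpleRoot_of_lt hk, refl_e_sub_e_apply (by simp [Fin.ext_iff])]
  · refine ⟨1, fun x i => ?_⟩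
    rw [simpleRoot_of_eq (by omega), refl_e_apply]
    split_ifs with h
    · subst h; exact Or.inr ⟨by omega, rfl⟩
    · exact Or.inl rfl

theorem exists_perm_abs {w : EuclideanSpace ℝ (Fin n) ≃ₗᵢ[ℝ] EuclideanSpace ℝ (Fin n)}
    (hw : w ∈ weyl (simpleRoots n)) : ∃ σ : Equiv.Perm (Fin n),
      ∀ (x : EuclideanSpace ℝ (Fin n)) (i : Fin n), |w x i| = |x (σ i)| := by
  induction hw using weyl_induction with
  | one => exact ⟨1, fun _ _ => rfl⟩
  | mul a ha w _ ih =>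
    obtain ⟨k, rfl⟩ := ha
    obtain ⟨σ, hσ⟩ := ih
    obtain ⟨τ, hτ⟩ := refl_simpleRoot_apply k
    refine ⟨σ * τ, fun x i => ?_⟩
    rw [mul_apply, Equiv.Perm.mul_apply, ← hσ]
    rcases hτ (w x) i with h | ⟨-, h⟩ <;> rw [h]
    rw [abs_neg]

theorem exists_perm_of_last_notMem {S : Set (EuclideanSpace ℝ (Fin n))} (hS : S ⊆ simpleRoots n)
    (hlast : ∀ k : Fin n, (k : ℕ) + 1 = n → simpleRoot k ∉ S)
    {w : EuclideanSpace ℝ (Fin n) ≃ₗᵢ[ℝ] EuclideanSpace ℝ (Fin n)} (hw : w ∈ weyl S) :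
    ∃ σ : Equiv.Perm (Fin n), ∀ (x : EuclideanSpace ℝ (Fin n)) (i : Fin n), w x i = x (σ i) := by
  induction hw using weyl_induction with
  | one => exact ⟨1, fun _ _ => rfl⟩
  | mul a ha w _ ih =>
    obtain ⟨k, rfl⟩ := hS ha
    obtain ⟨σ, hσ⟩ := ih
    obtain ⟨τ, hτ⟩ := refl_simpleRoot_apply k
    refine ⟨σ * τ, fun x i => ?_⟩
    rw [mul_apply, Equiv.Perm.mul_apply, ← hσ]
    rcases hτ (w x) i with h | ⟨h, -⟩
    · exact h
    · exact absurd ha (hlast k h)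

theorem refl_mem_weyl_of_ne {i j : Fin n} (hij : i ≠ j) :
    refl (e i - e j : EuclideanSpace ℝ (Fin n)) ∈ weyl (simpleRoots n) := by
  rcases hij.lt_or_gt with h | h
  · exact refl_e_sub_e_mem_weyl h
  · rw [← refl_neg, neg_sub]; exact refl_e_sub_e_mem_weyl h

theorem exists_mem_weyl_perm (σ : Equiv.Perm (Fin n)) :
    ∃ w ∈ weyl (simpleRoots n), ∀ (x : EuclideanSpace ℝ (Fin n)) (i : Fin n),
      w x i = x (σ i) := by
  induction σ using Equiv.Perm.swap_induction_on' with
  | one => exact ⟨1, one_mem _, fun _ _ => rfl⟩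
  | mul_swap σ i j hij ih =>
    obtain ⟨w, hw, h⟩ := ih
    refine ⟨refl (e i - e j) * w, mul_mem (refl_mem_weyl_of_ne hij) hw, fun x k => ?_⟩
    rw [mul_apply, refl_e_sub_e_apply hij, h, Equiv.Perm.mul_apply]

theorem exists_mem_weyl_pair {i j k l : Fin n} (hij : i ≠ j) (hkl : k ≠ l) :
    ∃ w ∈ weyl (simpleRoots n), ∀ x : EuclideanSpace ℝ (Fin n), w x i = x k ∧ w x j = x l := by
  -- The first transposition sends `i` to `k`; the second moves the image of `j` to `l` without
  -- touching `k`.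
  obtain ⟨w, hw, h⟩ := exists_mem_weyl_perm
    (Equiv.swap (Equiv.swap i k j) l * Equiv.swap i k)
  refine ⟨w, hw, fun x => ?_⟩
  rw [h, h, Equiv.Perm.mul_apply, Equiv.Perm.mul_apply, Equiv.swap_apply_left,
    Equiv.swap_apply_left]
  refine ⟨?_, rfl⟩
  rw [Equiv.swap_apply_of_ne_of_ne _ hkl]
  intro h'
  exact hij ((Equiv.swap i k).injective ((Equiv.swap_apply_left i k).trans h'))

theorem simpleRoot_injective : Function.Injective (simpleRoot : Fin n → _) := by
  intro i k hik
  have hi : (simpleRoot k : EuclideanSpace ℝ (Fin n)) i = 1 := by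
    rw [← hik]
    by_cases h : (i : ℕ) + 1 < n
    · rw [simpleRoot_of_lt h]; simp [e_apply, Fin.ext_iff]
    · rw [simpleRoot_of_eq (by omega)]; simp [e_apply]
  by_contra hne
  by_cases h : (k : ℕ) + 1 < n
  · rw [simpleRoot_of_lt h, PiLp.sub_apply, e_apply, e_apply, if_neg hne] at hi
    split_ifs at hi <;> norm_num at hi
  · rw [simpleRoot_of_eq (by omega), e_apply, if_neg hne] at hi
    norm_num at hi

/-! ### Weights in coordinates -/

section Weight

variable {S : Set (EuclideanSpace ℝ (Fin n))} {u : EuclideanSpace ℝ (Fin n)}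
  (hu : IsWeight (simpleRoots n) S u)

include hu

theorem weight_apply_nonneg (i : Fin n) : 0 ≤ u i := by
  rw [← inner_e]; exact hu.inner_posRoot_nonneg (e_mem_posRoots i)

theorem weight_apply_antitone {i j : Fin n} (h : i ≤ j) : u j ≤ u i := by
  rcases h.eq_or_lt with rfl | h
  · exact le_rfl
  · have := hu.inner_posRoot_nonneg (e_sub_e_mem_posRoots h)
    rwa [inner_sub_right, inner_e, inner_e, sub_nonneg] at this

theorem simpleRoot_mem_iff (i : Fin n) : simpleRoot i ∈ S ↔ ⟪u, simpleRoot i⟫ = 0 :=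
  ⟨hu.inner_eq_zero _, fun h => by_contra fun h' => (hu.inner_pos _ (simpleRoot_mem i) h').ne' h⟩

theorem refl_mem_weyl_of_inner_eq_zero {α : EuclideanSpace ℝ (Fin n)}
    (hα : refl α ∈ weyl (simpleRoots n)) (h : ⟪u, α⟫ = 0) : refl α ∈ weyl S :=
  ((isRootBase n).apply_weight_eq_iff hu hα).1 (refl_of_inner_eq_zero h)

theorem exists_apply_ne_zero (hS : S ⊆ simpleRoots n) (hne : S ≠ simpleRoots n) :
    ∃ i, u i ≠ 0 := by
  by_contra! h
  refine hne (hS.antisymm ?_)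
  rintro _ ⟨i, rfl⟩
  rw [simpleRoot_mem_iff hu, inner_simpleRoot, h i]
  split_ifs with h1
  · rw [h, sub_zero]
  · rw [sub_zero]

/-- The parabolic subsets that are empty or final segments are those for which the weight has no
repeated nonzero coordinates. -/
theorem injective_off_zero_iff (hS : S ⊆ simpleRoots n) :
    (∀ i j, i ≠ j → u i = u j → u i = 0) ↔
      S = ∅ ∨ ∃ p : Fin n, S = {β | ∃ i, p ≤ i ∧ β = simpleRoot i} := by
  constructor
  · intro h
    have hzero : ∀ i, simpleRoot i ∈ S → u i = 0 := by
      intro i hi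
      rw [simpleRoot_mem_iff hu, inner_simpleRoot] at hi
      split_ifs at hi with h1
      · exact h _ _ (by simp [Fin.ext_iff]) (sub_eq_zero.1 hi)
      · rwa [sub_zero] at hi
    rcases S.eq_empty_or_nonempty with h0 | ⟨a, ha⟩
    · exact Or.inl h0
    right
    classical
    obtain ⟨k, rfl⟩ := hS ha
    let T : Finset (Fin n) := Finset.univ.filter fun i => simpleRoot i ∈ S
    have hT : T.Nonempty := ⟨k, by simpa [T] using ha⟩
    have hp := T.min'_mem hT
    refine ⟨T.min' hT, Set.ext fun β => ⟨fun hβ => ?_, ?_⟩⟩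
    · obtain ⟨i, rfl⟩ := hS hβ
      exact ⟨i, T.min'_le i (by simpa [T] using hβ), rfl⟩
    · rintro ⟨i, hi, rfl⟩
      have h0 := hzero _ (by simpa [T] using hp)
      have hz : ∀ j, T.min' hT ≤ j → u j = 0 := fun j hj =>
        le_antisymm (h0 ▸ weight_apply_antitone hu hj) (weight_apply_nonneg hu j)
      rw [simpleRoot_mem_iff hu, inner_simpleRoot, hz i hi]
      split_ifs with h1
      · rw [hz _ (hi.trans (by rw [Fin.le_def]; simp)), sub_zero]
      · rw [sub_zero]
  · intro h i j hij huij
    wlog hlt : i < j generalizing i j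
    · rw [huij]
      exact this j i hij.symm huij.symm (hij.lt_or_gt.resolve_left hlt)
    have h1 : (i : ℕ) + 1 < n := by rw [Fin.lt_def] at hlt; omega
    have h2 : simpleRoot i ∈ S := by
      rw [simpleRoot_mem_iff hu, inner_simpleRoot, dif_pos h1, sub_eq_zero]
      refine le_antisymm ?_ (weight_apply_antitone hu (by rw [Fin.le_def]; simp))
      rw [huij]
      exact weight_apply_antitone hu (by rw [Fin.le_def]; simpa using hlt)
    rcases h with rfl | ⟨p, rfl⟩
    · exact absurd h2 (Set.notMem_empty _)
    obtain ⟨k, hk, hik⟩ := h2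
    have hseg : ∀ t, p ≤ t → u t = 0 := by
      intro t ht
      -- Downward induction from the last coordinate: `m` is the distance from `t` to the last
      -- index.
      obtain ⟨m, hm⟩ := Nat.exists_eq_add_of_lt t.2
      induction m generalizing t with
      | zero =>
        have := hu.inner_eq_zero _ ⟨t, ht, rfl⟩
        rwa [inner_simpleRoot, dif_neg (by omega), sub_zero] at this
      | succ m ih =>
        have := hu.inner_eq_zero _ ⟨t, ht, rfl⟩
        rwa [inner_simpleRoot, dif_pos (by omega),
          ih ⟨t + 1, by omega⟩ (ht.trans (by rw [Fin.le_def]; simp)) (by simp; omega),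
          sub_zero] at this
    rw [simpleRoot_injective hik]
    exact hseg k hk

end Weight

variable {ΘP ΘQ : Set (EuclideanSpace ℝ (Fin n))} {v u : EuclideanSpace ℝ (Fin n)}

/-! ### Obstructions -/

theorem apply_e_ne_e_add_e (c : EuclideanSpace ℝ (Fin n) ≃ₗᵢ[ℝ] EuclideanSpace ℝ (Fin n))
    {i j : Fin n} (hij : i ≠ j) : c (e i) ≠ e i + e j := by
  intro h
  have h1 : ⟪c (e i), c (e i)⟫ = ⟪e i + e j, e i + e j⟫ := by rw [h]
  rw [LinearIsometryEquiv.inner_map_map, inner_add_left, inner_e_left, inner_e_left,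
    inner_e_left] at h1
  simp [e_apply, hij, hij.symm] at h1

/-- If `v a = v b = r ≠ 0`, place these values at positions `i` and `l`. There `s_{e_i}` gives `(-r,
r)` and `s_{e_i + e_l}` gives `(-r, -r)`. These differ by the sign change at `l`, which is in `W_Q`
because `u l = 0`, although the two roots have different lengths. -/
theorem left_injective_of_edgesConjugate
    (h : EdgesConjugate (roots n) (simpleRoots n) ΘQ v u) (hu : IsWeight (simpleRoots n) ΘQ u)
    (hv : IsWeight (simpleRoots n) ΘP v) {i l : Fin n} (hi : u i ≠ 0) (hl : u l = 0)
    {a b : Fin n} (hab : a ≠ b) (hvab : v a = v b) : v a = 0 := by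
  by_contra ha
  have hil : i ≠ l := by rintro rfl; exact hi hl
  obtain ⟨w, hw, hwx⟩ := exists_mem_weyl_pair hil hab
  obtain ⟨h1, h2⟩ := hwx v
  have hpos := (weight_apply_nonneg hv a).lt_of_ne' ha
  have hui := (weight_apply_nonneg hu i).lt_of_ne' hi
  obtain ⟨c, -, -, hc⟩ := h w hw (e i) (e_mem_posRoots i) (e i + e l) (e_add_e_mem_posRoots hil)
    (by rw [inner_e, h1]; exact hpos)
    (by rw [inner_add_right, inner_e, inner_e, h1, h2, ← hvab]; exact add_pos hpos hpos)
    (by rwa [inner_e]) (by rwa [inner_add_right, inner_e, inner_e, hl, add_zero])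
    ⟨refl (e l), refl_mem_weyl_of_inner_eq_zero hu (refl_e_mem_weyl l) (by rwa [inner_e]), by
      ext k
      rw [refl_e_apply, refl_e_apply, refl_e_apply, refl_e_add_e_apply hil,
        Equiv.swap_apply_def, if_neg hil.symm]
      by_cases hk : k = i
      · subst hk; simp [hil, h1, h2, hvab]
      · by_cases hk' : k = l
        · subst hk'; simp [hk, h1, h2, hvab]
        · simp [hk, hk']⟩
  exact apply_e_ne_e_add_e c hil hc

/-- Place a nonzero value `r` of `v` at `i` and a zero at `j`, where `u i = u j ≠ 0`. Then `s_{e_i}`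
gives `(-r, 0)` and `s_{e_i + e_j}` gives `(0, -r)`, which are exchanged by a transposition in
`W_Q`. -/
theorem right_injective_of_edgesConjugate
    (h : EdgesConjugate (roots n) (simpleRoots n) ΘQ v u) (hu : IsWeight (simpleRoots n) ΘQ u)
    (hv : IsWeight (simpleRoots n) ΘP v) {a l : Fin n} (ha : v a ≠ 0) (hl : v l = 0)
    {i j : Fin n} (hij : i ≠ j) (huij : u i = u j) : u i = 0 := by
  by_contra hi
  have hal : a ≠ l := by rintro rfl; exact ha hl
  obtain ⟨w, hw, hwx⟩ := exists_mem_weyl_pair hij hal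
  obtain ⟨h1, h2⟩ := hwx v
  have hpos := (weight_apply_nonneg hv a).lt_of_ne' ha
  have hui := (weight_apply_nonneg hu i).lt_of_ne' hi
  obtain ⟨c, -, -, hc⟩ := h w hw (e i) (e_mem_posRoots i) (e i + e j) (e_add_e_mem_posRoots hij)
    (by rw [inner_e, h1]; exact hpos)
    (by rwa [inner_add_right, inner_e, inner_e, h1, h2, hl, add_zero])
    (by rwa [inner_e]) (by rw [inner_add_right, inner_e, inner_e, ← huij]; exact add_pos hui hui)
    ⟨refl (e i - e j), refl_mem_weyl_of_inner_eq_zero hu (refl_mem_weyl_of_ne hij)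
        (by rw [inner_sub_right, inner_e, inner_e, huij, sub_self]), by
      ext k
      rw [refl_e_sub_e_apply hij, refl_e_apply, refl_e_add_e_apply hij, Equiv.swap_apply_def]
      by_cases hk : k = i
      · subst hk; simp [hij, hij.symm, h2, hl]
      · by_cases hk' : k = j
        · subst hk'; simp [hk]
        · simp [hk, hk']⟩
  exact apply_e_ne_e_add_e c hij hc

/-! ### Final segments -/

theorem refl_e_add_smul_e {i j : Fin n} (hij : i ≠ j) {s : ℝ} (hs : s = 1 ∨ s = -1)
    (x : EuclideanSpace ℝ (Fin n)) :
    refl (e i + s • e j) x = x - (x i + s * x j) • (e i + s • e j) := by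
  have h : ‖(e i + s • e j : EuclideanSpace ℝ (Fin n))‖ ^ 2 = 2 := by
    rw [← real_inner_self_eq_norm_sq, inner_add_left, inner_smul_left, inner_e_left, inner_e_left]
    rcases hs with rfl | rfl <;> simp [e_apply, hij, hij.symm] <;> norm_num
  rw [refl_apply, h, inner_add_left, inner_smul_left, inner_e_left, inner_e_left]
  congr 2
  simp only [conj_trivial]
  ring

theorem refl_e_eq (i : Fin n) (x : EuclideanSpace ℝ (Fin n)) :
    refl (e i) x = x - (2 * x i) • e i := by
  rw [refl_apply, inner_e_left]; simp [e]

/-- A positive root that is not orthogonal to a weight `u` starts at a coordinate `i` with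
`u i ≠ 0`. -/
theorem eq_e_or_eq_e_add_smul_e (hu : IsWeight (simpleRoots n) ΘQ u)
    {α : EuclideanSpace ℝ (Fin n)} (hα : α ∈ posRoots (roots n) (simpleRoots n))
    (h : 0 < ⟪u, α⟫) : ∃ i, u i ≠ 0 ∧
      (α = e i ∨ ∃ (j : Fin n) (s : ℝ), i < j ∧ (s = 1 ∨ s = -1) ∧ α = e i + s • e j) := by
  rcases mem_posRoots_iff.1 hα with ⟨i, j, hij, rfl | rfl⟩ | ⟨i, rfl⟩
  · refine ⟨i, fun h0 => ?_, Or.inr ⟨j, 1, hij, Or.inl rfl, by rw [one_smul]⟩⟩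
    rw [inner_add_right, inner_e, inner_e] at h
    linarith [weight_apply_antitone hu hij.le]
  · refine ⟨i, fun h0 => ?_, Or.inr ⟨j, -1, hij, Or.inr rfl, by rw [neg_one_smul]; abel⟩⟩
    rw [inner_sub_right, inner_e, inner_e] at h
    linarith [weight_apply_nonneg hu j]
  · refine ⟨i, fun h0 => ?_, Or.inl rfl⟩
    rw [inner_e] at h; linarith

/-- Each simple root in `ΘQ` involves only coordinates where `u` vanishes, since equal neighbouring
coordinates of `u` are zero. So `e i` is orthogonal to all of `ΘQ`. -/
theorem apply_eq_of_mem_weyl (hQ : ΘQ ⊆ simpleRoots n) (hu : IsWeight (simpleRoots n) ΘQ u)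
    (hinj : ∀ i j, i ≠ j → u i = u j → u i = 0)
    {c : EuclideanSpace ℝ (Fin n) ≃ₗᵢ[ℝ] EuclideanSpace ℝ (Fin n)} (hc : c ∈ weyl ΘQ) {i : Fin n}
    (hi : u i ≠ 0) (x : EuclideanSpace ℝ (Fin n)) : c x i = x i := by
  have h : ∀ a ∈ ΘQ, ⟪e i, a⟫ = 0 := by
    intro a ha
    obtain ⟨k, rfl⟩ := hQ ha
    have h0 := hu.inner_eq_zero _ ha
    have hne : ∀ j, u j = 0 → j ≠ i := by rintro j hj rfl; exact hi hj
    rw [inner_simpleRoot] at h0 ⊢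
    by_cases h1 : (k : ℕ) + 1 < n
    · rw [dif_pos h1] at h0 ⊢
      have h2 := hinj k ⟨k + 1, h1⟩ (by simp [Fin.ext_iff]) (sub_eq_zero.1 h0)
      rw [h2, zero_sub, neg_eq_zero] at h0
      rw [e_apply, e_apply, if_neg (hne _ h2), if_neg (hne _ h0), sub_zero]
    · rw [dif_neg h1, sub_zero] at h0 ⊢
      rw [e_apply, if_neg (hne _ h0)]
  rw [← inner_e, inner_apply_left, apply_eq_self_of_mem_weyl h (inv_mem hc), inner_e]

/-- The two reflected points agree wherever `u` is nonzero. The first coordinate that `s_α` changes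
is such a place, so both roots start at the same index `i`. The new value there, `-x i` for `e i`
and `-s * x j` for `e i + s • e j`, distinguishes short from long roots and fixes `|x j|`. Any
remaining ambiguity sits at coordinates where `x` and `u` both vanish, where `W_Q` contains all
signs and permutations. -/
theorem edgesConjugate_of_injective (hQ : ΘQ ⊆ simpleRoots n)
    (hv : IsWeight (simpleRoots n) ΘP v) (hu : IsWeight (simpleRoots n) ΘQ u)
    (hvinj : ∀ i j, i ≠ j → v i = v j → v i = 0) (huinj : ∀ i j, i ≠ j → u i = u j → u i = 0) :
    EdgesConjugate (roots n) (simpleRoots n) ΘQ v u := by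
  rintro w hw α hα β hβ hxα hxβ huα huβ ⟨c, hc, hαβ⟩
  obtain ⟨σ, hσ⟩ := exists_perm_abs hw
  have hx : ∀ i j, i ≠ j → |w v i| = |w v j| → w v i = 0 := by
    intro i j hij h
    rw [hσ, hσ, abs_of_nonneg (weight_apply_nonneg hv _),
      abs_of_nonneg (weight_apply_nonneg hv _)] at h
    rw [← abs_eq_zero, hσ, hvinj _ _ (σ.injective.ne hij) h, abs_zero]
  set x := w v
  have heq : ∀ k, u k ≠ 0 → refl α x k = refl β x k := by
    intro k hk
    rw [← hαβ, apply_eq_of_mem_weyl hQ hu huinj hc hk]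
  clear hαβ hc c hσ
  obtain ⟨i, hi, hα'⟩ := eq_e_or_eq_e_add_smul_e hu hα huα
  obtain ⟨i', hi', hβ'⟩ := eq_e_or_eq_e_add_smul_e hu hβ huβ
  have hlead : ∀ (γ : EuclideanSpace ℝ (Fin n)) (k : Fin n), 0 < ⟪x, γ⟫ →
      (γ = e k ∨ ∃ (j : Fin n) (s : ℝ), k < j ∧ (s = 1 ∨ s = -1) ∧ γ = e k + s • e j) →
      refl γ x k ≠ x k ∧ ∀ l < k, refl γ x l = x l := by
    rintro γ k hpos (rfl | ⟨j, s, hkj, hs, rfl⟩)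
    · rw [inner_e] at hpos
      refine ⟨?_, fun l hl => ?_⟩ <;> rw [refl_e_eq]
      · simp [e_apply, hpos.ne']
      · simp [e_apply, hl.ne]
    · rw [inner_add_right, inner_smul_right, inner_e, inner_e] at hpos
      refine ⟨?_, fun l hl => ?_⟩ <;> rw [refl_e_add_smul_e hkj.ne hs]
      · simp only [PiLp.sub_apply, PiLp.smul_apply, PiLp.add_apply, e_apply, if_neg hkj.ne,
          if_true, smul_eq_mul, mul_zero, add_zero, mul_one, ne_eq, sub_eq_self]
        exact hpos.ne'
      · simp [e_apply, hl.ne, (hl.trans hkj).ne]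
  obtain ⟨ha1, ha2⟩ := hlead α i hxα hα'
  obtain ⟨hb1, hb2⟩ := hlead β i' hxβ hβ'
  have hsame : i = i' := by
    rcases lt_trichotomy i i' with h | h | h
    · exact absurd ((heq i hi).trans (hb2 i h)) ha1
    · exact h
    · exact absurd ((heq i' hi').symm.trans (ha2 i' h)) hb1
  subst hsame
  -- Equality would give `|x j| = |x i|` with `x i ≠ 0`, against the distinctness of the nonzero
  -- absolute values.
  have hmixed : ∀ (j : Fin n) (s : ℝ), i < j → (s = 1 ∨ s = -1) → 0 < x i →
      refl (e i + s • e j) x i ≠ refl (e i) x i := by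
    intro j s hij hs hpos h
    rw [refl_e_add_smul_e hij.ne hs, refl_e_eq] at h
    simp [e_apply, hij.ne] at h
    have h0 := hx i j hij.ne (by
      rcases hs with rfl | rfl
      · congr 1; linarith
      · rw [← abs_neg (x j)]; congr 1; linarith)
    exact hpos.ne' h0
  rcases hα' with rfl | ⟨j, s, hij, hs, rfl⟩ <;> rcases hβ' with rfl | ⟨l, t, hil, ht, rfl⟩
  · exact ⟨1, one_mem _, rfl, rfl⟩
  · rw [inner_e] at hxα
    exact absurd (heq i hi).symm (hmixed l t hil ht hxα)
  · rw [inner_e] at hxβ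
    exact absurd (heq i hi) (hmixed j s hij hs hxβ)
  · have h1 : s * x j = t * x l := by
      have := heq i hi
      rw [refl_e_add_smul_e hij.ne hs, refl_e_add_smul_e hil.ne ht] at this
      simp [e_apply, hij.ne, hil.ne] at this
      linarith
    have habs : |x j| = |x l| := by
      rcases hs with rfl | rfl <;> rcases ht with rfl | rfl <;>
        [skip; rw [← abs_neg (x l)]; rw [← abs_neg (x j)]; skip] <;> congr 1 <;> linarith
    have hA : x i + s * x j ≠ 0 := by
      rw [inner_add_right, inner_smul_right, inner_e, inner_e] at hxα
      exact hxα.ne'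
    -- By `h1` both reflections subtract the same nonzero multiple of their roots, so the roots
    -- agree at every coordinate where `u` is nonzero.
    have hcoord : ∀ k, u k ≠ 0 → k ≠ i → s * (if k = j then 1 else 0) =
        t * (if k = l then 1 else 0) := by
      intro k hk hki
      have := heq k hk
      rw [refl_e_add_smul_e hij.ne hs, refl_e_add_smul_e hil.ne ht, ← h1] at this
      simp only [PiLp.sub_apply, PiLp.smul_apply, PiLp.add_apply, e_apply, smul_eq_mul,
        if_neg hki, zero_add, sub_right_inj] at this
      exact mul_left_cancel₀ hA this
    have hs0 : s ≠ 0 := by rcases hs with rfl | rfl <;> norm_num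
    have ht0 : t ≠ 0 := by rcases ht with rfl | rfl <;> norm_num
    have hts : s ≠ t → t = -s := by
      intro hst
      rcases hs with hs | hs <;> rcases ht with ht | ht
      · exact absurd (hs.trans ht.symm) hst
      · rw [hs, ht]
      · rw [hs, ht, neg_neg]
      · exact absurd (hs.trans ht.symm) hst
    by_cases hjl : j = l
    · subst hjl
      by_cases hst : s = t
      · subst hst; exact ⟨1, one_mem _, rfl, rfl⟩
      · have hts := hts hst
        have huj : u j = 0 := by
          by_contra huj
          have := hcoord j huj hij.ne'
          simp at this
          exact hst this
        have hxj : x j = 0 := by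
          rw [hts] at h1
          have : s * x j = 0 := by linarith
          exact (mul_eq_zero.1 this).resolve_left hs0
        refine ⟨refl (e j), refl_mem_weyl_of_inner_eq_zero hu (refl_e_mem_weyl j)
          (by rwa [inner_e]), refl_of_inner_eq_zero (by rwa [inner_e]), ?_⟩
        rw [map_add, map_smul, refl_e_e, refl_e_e, if_neg hij.ne, if_pos rfl, hts, smul_neg,
          neg_smul]
    · have hxj : x j = 0 := hx j l hjl habs
      have hxl : x l = 0 := hx l j (Ne.symm hjl) habs.symm
      have huj : u j = 0 := by
        by_contra huj
        have := hcoord j huj hij.ne'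
        simp [hjl] at this
        exact hs0 this
      have hul : u l = 0 := by
        by_contra hul
        have := hcoord l hul hil.ne'
        simp [Ne.symm hjl] at this
        exact ht0 this.symm
      by_cases hst : s = t
      · subst hst
        refine ⟨refl (e j - e l), refl_mem_weyl_of_inner_eq_zero hu (refl_mem_weyl_of_ne hjl) ?_,
          refl_of_inner_eq_zero ?_, ?_⟩
        · rw [inner_sub_right, inner_e, inner_e, huj, hul, sub_zero]
        · rw [inner_sub_right, inner_e, inner_e, hxj, hxl, sub_zero]
        · rw [map_add, map_smul, refl_e_sub_e_e hjl, refl_e_sub_e_e hjl, Equiv.swap_apply_left,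
            Equiv.swap_apply_of_ne_of_ne hij.ne hil.ne]
      · have hts := hts hst
        have hjl' : e j + e l ∈ posRoots (roots n) (simpleRoots n) := e_add_e_mem_posRoots hjl
        refine ⟨refl (e j + e l), refl_mem_weyl_of_inner_eq_zero hu
          (refl_mem_weyl_of_mem_posRoots hjl') ?_, refl_of_inner_eq_zero ?_, ?_⟩
        · rw [inner_add_right, inner_e, inner_e, huj, hul, add_zero]
        · rw [inner_add_right, inner_e, inner_e, hxj, hxl, add_zero]
        · rw [map_add, map_smul, refl_e_add_e_e hjl, refl_of_inner_eq_zero, hts, smul_neg,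
            neg_smul]
          rw [inner_add_right, inner_e, inner_e, e_apply, e_apply, if_neg hij.ne', if_neg hil.ne',
            add_zero]

/-! ### Weights without zero coordinates -/

/-- Disjoint multisets are the positive and negative parts of their difference, so that difference
determines them. -/
theorem eq_of_add_eq_add_of_disjoint {X : Type*} {A A' B B' : Multiset X} (h : A + B' = B + A')
    (hA : Disjoint A A') (hB : Disjoint B B') : A = B ∧ A' = B' := by
  classical
  have h0 : ∀ p, A.count p = B.count p ∧ A'.count p = B'.count p := by
    intro p
    have h1 := congrArg (Multiset.count p) h
    rw [Multiset.count_add, Multiset.count_add] at h1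
    have h2 : A.count p = 0 ∨ A'.count p = 0 := by
      rw [Multiset.count_eq_zero, Multiset.count_eq_zero]
      by_contra! h
      exact Multiset.disjoint_left.1 hA h.1 h.2
    have h3 : B.count p = 0 ∨ B'.count p = 0 := by
      rw [Multiset.count_eq_zero, Multiset.count_eq_zero]
      by_contra! h
      exact Multiset.disjoint_left.1 hB h.1 h.2
    omega
  exact ⟨Multiset.ext.2 fun p => (h0 p).1, Multiset.ext.2 fun p => (h0 p).2⟩

theorem pair_eq_pair {X : Type*} {a b c d : X} (h : ({a, b} : Multiset X) = {c, d}) :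
    (a = c ∧ b = d) ∨ (a = d ∧ b = c) := by
  have h' : s(a, b) = s(c, d) := Sym2.eq_iff.2 ?_
  · simpa using h'
  simp only [Multiset.insert_eq_cons, Multiset.cons_eq_cons, Multiset.singleton_inj] at h
  rcases h with h | ⟨-, cs, h1, h2⟩
  · exact Or.inl h
  · rw [Multiset.singleton_eq_cons_iff] at h1 h2
    exact Or.inr ⟨h2.1.symm, h1.1⟩

/-- The pairs formed by the coordinates of `u` and `x`. -/
def coordPairs (u x : EuclideanSpace ℝ (Fin n)) : Multiset (ℝ × ℝ) :=
  Finset.univ.val.map fun i => (u i, x i)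

theorem coordPairs_comp (σ : Equiv.Perm (Fin n)) {x y : EuclideanSpace ℝ (Fin n)}
    (hu : ∀ i, u i = u (σ i)) (hy : ∀ i, y i = x (σ i)) : coordPairs u y = coordPairs u x := by
  unfold coordPairs
  conv_rhs => rw [← Multiset.map_univ_val_equiv σ, Multiset.map_map]
  exact Multiset.map_congr rfl fun i _ => by rw [hu i, hy i]; rfl

theorem coordPairs_add (T : Finset (Fin n)) {x y : EuclideanSpace ℝ (Fin n)}
    (h : ∀ k ∉ T, y k = x k) :
    coordPairs u x + T.val.map (fun i => (u i, y i)) =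
      coordPairs u y + T.val.map fun i => (u i, x i) := by
  have hsplit : ∀ z : EuclideanSpace ℝ (Fin n), coordPairs u z =
      T.val.map (fun i => (u i, z i)) + Tᶜ.val.map fun i => (u i, z i) := by
    intro z
    unfold coordPairs
    rw [← Multiset.map_add, ← Finset.union_compl T, ← Finset.disjUnion_eq_union _ _
      disjoint_compl_right, Finset.disjUnion_val]
  have hc : Tᶜ.val.map (fun i => (u i, y i)) = Tᶜ.val.map fun i => (u i, x i) :=
    Multiset.map_congr rfl fun i hi => by rw [h i (Finset.mem_compl.1 hi)]
  rw [hsplit x, hsplit y, hc, add_right_comm, add_comm (T.val.map _) (T.val.map _),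
    add_right_comm]

/-- The effect of a reflection on the coordinate pairs: the pairs in `L` are replaced by those
in `G`. -/
theorem exists_coordPairs_refl {x α : EuclideanSpace ℝ (Fin n)} (hx : ∀ i, x i ≠ 0)
    (hα : α ∈ posRoots (roots n) (simpleRoots n)) (hxα : 0 < ⟪x, α⟫) (huα : 0 < ⟪u, α⟫) :
    ∃ L G : Multiset (ℝ × ℝ), Disjoint L G ∧
      coordPairs u x + G = coordPairs u (refl α x) + L ∧
      ((∃ i, α = e i ∧ L = {(u i, x i)}) ∨
        (∃ i j, i ≠ j ∧ α = e i + e j ∧ L = {(u i, x i), (u j, x j)} ∧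
          G = {(u i, -x j), (u j, -x i)}) ∨
        ∃ i j, i ≠ j ∧ α = e i - e j ∧ L = {(u i, x i), (u j, x j)} ∧
          G = {(u i, x j), (u j, x i)}) := by
  have hpair : ∀ {i j : Fin n} (hij : i ≠ j) (f : Fin n → ℝ × ℝ),
      ({i, j} : Finset (Fin n)).val.map f = {f i, f j} := by
    intro i j hij f
    rw [Finset.insert_val_of_notMem (by simpa using hij)]
    simp
  rcases mem_posRoots_iff.1 hα with ⟨i, j, hij, rfl | rfl⟩ | ⟨i, rfl⟩
  · have hij := hij.ne
    rw [inner_add_right, inner_e, inner_e] at hxα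
    refine ⟨{(u i, x i), (u j, x j)}, {(u i, -x j), (u j, -x i)}, ?_, ?_,
      Or.inr (Or.inl ⟨i, j, hij, rfl, rfl, rfl⟩)⟩
    -- Nonzero coordinates matter here: when `u i = u j`, the pairs `(u i, x i)` and `(u j, -x i)`
    -- would coincide if `x i = 0`.
    · have h1 := hx i
      have h2 := hx j
      rw [Multiset.disjoint_left]
      simp only [Multiset.insert_eq_cons, Multiset.mem_cons, Multiset.mem_singleton]
      rintro p (rfl | rfl) (h | h) <;> rw [Prod.mk.injEq] at h <;> obtain ⟨-, h⟩ := h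
      · linarith
      · exact h1 (by linarith)
      · exact h2 (by linarith)
      · linarith
    · have h := coordPairs_add (u := u) {i, j} (x := x) (y := refl (e i + e j) x) (by
        intro k hk
        simp only [Finset.mem_insert, Finset.mem_singleton] at hk
        rw [refl_e_add_e_apply hij, if_neg hk])
      rw [hpair hij, hpair hij] at h
      simpa [refl_e_add_e_apply hij] using h
  · have hij := hij.ne
    rw [inner_sub_right, inner_e, inner_e] at hxα huα
    refine ⟨{(u i, x i), (u j, x j)}, {(u i, x j), (u j, x i)}, ?_, ?_,
      Or.inr (Or.inr ⟨i, j, hij, rfl, rfl, rfl⟩)⟩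
    · rw [Multiset.disjoint_left]
      simp only [Multiset.insert_eq_cons, Multiset.mem_cons, Multiset.mem_singleton]
      rintro p (rfl | rfl) (h | h) <;> rw [Prod.mk.injEq] at h <;> obtain ⟨h, h'⟩ := h <;>
        linarith
    · have h := coordPairs_add (u := u) {i, j} (x := x) (y := refl (e i - e j) x) (by
        intro k hk
        simp only [Finset.mem_insert, Finset.mem_singleton, not_or] at hk
        rw [refl_e_sub_e_apply hij, Equiv.swap_apply_of_ne_of_ne hk.1 hk.2])
      rw [hpair hij, hpair hij] at h
      simpa [refl_e_sub_e_apply hij] using h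
  · rw [inner_e] at hxα
    refine ⟨{(u i, x i)}, {(u i, -x i)}, ?_, ?_, Or.inl ⟨i, rfl, rfl⟩⟩
    · rw [Multiset.disjoint_left]
      simp only [Multiset.mem_singleton]
      rintro p rfl h
      rw [Prod.mk.injEq] at h
      linarith [h.2]
    · have h := coordPairs_add (u := u) {i} (x := x) (y := refl (e i) x) (by
        intro k hk
        rw [refl_e_apply, if_neg (by simpa using hk)])
      simpa [refl_e_apply] using h

theorem exists_swap_mem_weyl (hu : IsWeight (simpleRoots n) ΘQ u) {x : EuclideanSpace ℝ (Fin n)}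
    {i k : Fin n} (h : (u i, x i) = (u k, x k)) :
    ∃ c ∈ weyl ΘQ, c x = x ∧ ∀ m, c (e m) = e (Equiv.swap i k m) := by
  rw [Prod.mk.injEq] at h
  by_cases hik : i = k
  · subst hik
    exact ⟨1, one_mem _, rfl, fun m => by rw [Equiv.swap_self]; rfl⟩
  · refine ⟨refl (e i - e k), refl_mem_weyl_of_inner_eq_zero hu (refl_mem_weyl_of_ne hik) ?_,
      refl_of_inner_eq_zero ?_, refl_e_sub_e_e hik⟩
    · rw [inner_sub_right, inner_e, inner_e, h.1, sub_self]
    · rw [inner_sub_right, inner_e, inner_e, h.2, sub_self]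

theorem exists_pair_mem_weyl (hu : IsWeight (simpleRoots n) ΘQ u) {x : EuclideanSpace ℝ (Fin n)}
    {i j k l : Fin n} (hij : i ≠ j) (hkl : k ≠ l) (hik : (u i, x i) = (u k, x k))
    (hjl : (u j, x j) = (u l, x l)) :
    ∃ c ∈ weyl ΘQ, c x = x ∧ c (e i) = e k ∧ c (e j) = e l := by
  obtain ⟨c, hc, hcx, hce⟩ := exists_swap_mem_weyl hu hik
  have h1 : (u (Equiv.swap i k j), x (Equiv.swap i k j)) = (u l, x l) := by
    by_cases h : j = k
    · rw [h, Equiv.swap_apply_right, hik, ← h, hjl]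
    · rw [Equiv.swap_apply_of_ne_of_ne hij.symm h, hjl]
  obtain ⟨d, hd, hdx, hde⟩ := exists_swap_mem_weyl hu h1
  refine ⟨d * c, mul_mem hd hc, by rw [mul_apply, hcx, hdx], ?_, ?_⟩
  · rw [mul_apply, hce, hde, Equiv.swap_apply_left, Equiv.swap_apply_of_ne_of_ne _ hkl]
    intro h
    exact hij ((Equiv.swap i k).injective ((Equiv.swap_apply_left i k).trans h))
  · rw [mul_apply, hce, hde, Equiv.swap_apply_left]

/-- Since `W_Q` permutes coordinates and fixes `u`, points in one `W_Q`-orbit have the same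
coordinate pairs. Hence both reflections remove the same pairs `L` and add the same pairs `G`. The
size of `L` separates short from long roots, `G` separates `e_i + e_j` from `e_i - e_j`, and indices
with equal pairs are exchanged by elements of `W_Q` fixing `x`. -/
theorem edgesConjugate_of_ne_zero (hQ : ΘQ ⊆ simpleRoots n)
    (hu : IsWeight (simpleRoots n) ΘQ u)
    (hv0 : ∀ i, v i ≠ 0) (hu0 : ∀ i, u i ≠ 0) :
    EdgesConjugate (roots n) (simpleRoots n) ΘQ v u := by
  rintro w hw α hα β hβ hxα hxβ huα huβ ⟨c, hc, hαβ⟩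
  have hx : ∀ i, w v i ≠ 0 := by
    intro i
    obtain ⟨σ, hσ⟩ := exists_perm_abs hw
    rw [← abs_pos, hσ, abs_pos]
    exact hv0 _
  set x := w v
  have hlast : ∀ k : Fin n, (k : ℕ) + 1 = n → simpleRoot k ∉ ΘQ := by
    intro k hk h
    rw [simpleRoot_mem_iff hu, inner_simpleRoot, dif_neg (by omega), sub_zero] at h
    exact hu0 k h
  obtain ⟨σ, hσ⟩ := exists_perm_of_last_notMem hQ hlast hc
  have hpairs : coordPairs u (refl β x) = coordPairs u (refl α x) := by
    refine coordPairs_comp σ (fun i => ?_) (fun i => ?_)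
    · rw [← hσ, apply_eq_self_of_mem_weyl hu.inner_eq_zero hc]
    · rw [← hσ, hαβ]
  obtain ⟨L, G, hd, h1, hL⟩ := exists_coordPairs_refl hx hα hxα huα
  obtain ⟨L', G', hd', h1', hL'⟩ := exists_coordPairs_refl hx hβ hxβ huβ
  have h2 : G + L' = G' + L := by
    refine add_left_cancel (a := coordPairs u x) ?_
    rw [← add_assoc, ← add_assoc, h1, h1', hpairs, add_right_comm]
  obtain ⟨hG, hLL⟩ := eq_of_add_eq_add_of_disjoint h2 hd.symm hd'.symm
  subst hG hLL
  clear h1 h1' h2 hd hd' hpairs hαβ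
  have hcard : ∀ (a b d : ℝ × ℝ), ({a} : Multiset (ℝ × ℝ)) ≠ {b, d} := by
    intro a b d h
    simpa using congrArg Multiset.card h
  rcases hL with ⟨i, rfl, h⟩ | ⟨i, j, hij, rfl, h, hG⟩ | ⟨i, j, hij, rfl, h, hG⟩ <;>
    rcases hL' with ⟨k, rfl, h'⟩ | ⟨k, l, hkl, rfl, h', hG'⟩ | ⟨k, l, hkl, rfl, h', hG'⟩
  · rw [h, Multiset.singleton_inj] at h'
    obtain ⟨c, hc, hcx, hce⟩ := exists_swap_mem_weyl hu h'
    exact ⟨c, hc, hcx, by rw [hce, Equiv.swap_apply_left]⟩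
  · exact absurd (h.symm.trans h') (hcard _ _ _)
  · exact absurd (h.symm.trans h') (hcard _ _ _)
  · exact absurd (h'.symm.trans h) (hcard _ _ _)
  · rcases pair_eq_pair (h.symm.trans h') with ⟨h1, h2⟩ | ⟨h1, h2⟩
    · obtain ⟨c, hc, hcx, hci, hcj⟩ := exists_pair_mem_weyl hu hij hkl h1 h2
      exact ⟨c, hc, hcx, by rw [map_add, hci, hcj]⟩
    · obtain ⟨c, hc, hcx, hci, hcj⟩ := exists_pair_mem_weyl hu hij hkl.symm h1 h2
      exact ⟨c, hc, hcx, by rw [map_add, hci, hcj, add_comm]⟩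
  -- For `e k - e l` both `u k > u l` and `x k > x l` hold. Matching the removed and the added pairs
  -- in any order contradicts these inequalities.
  · exfalso
    rw [inner_sub_right, inner_e, inner_e] at hxβ huβ
    rcases pair_eq_pair (h.symm.trans h') with ⟨h1, h2⟩ | ⟨h1, h2⟩ <;>
      rcases pair_eq_pair (hG.symm.trans hG') with ⟨h3, h4⟩ | ⟨h3, h4⟩ <;>
      simp only [Prod.mk.injEq] at h1 h2 h3 h4 <;> linarith
  · exact absurd (h'.symm.trans h) (hcard _ _ _)
  · exfalso
    rw [inner_sub_right, inner_e, inner_e] at hxα huα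
    rcases pair_eq_pair (h.symm.trans h') with ⟨h1, h2⟩ | ⟨h1, h2⟩ <;>
      rcases pair_eq_pair (hG.symm.trans hG') with ⟨h3, h4⟩ | ⟨h3, h4⟩ <;>
      simp only [Prod.mk.injEq] at h1 h2 h3 h4 <;> linarith
  · rw [inner_sub_right, inner_e, inner_e] at hxα hxβ
    rcases pair_eq_pair (h.symm.trans h') with ⟨h1, h2⟩ | ⟨h1, h2⟩
    · obtain ⟨c, hc, hcx, hci, hcj⟩ := exists_pair_mem_weyl hu hij hkl h1 h2
      exact ⟨c, hc, hcx, by rw [map_sub, hci, hcj]⟩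
    · simp only [Prod.mk.injEq] at h1 h2
      linarith

end TypeB

end DoubleMoment

/-! ### The classification -/

open DoubleMoment DoubleMoment.TypeB

theorem mainTheorem6 (n : ℕ) (hn : 2 ≤ n) (ΘP ΘQ : Set (EuclideanSpace ℝ (Fin n)))
    (hP : ΘP ⊆ DoubleMoment.TypeB.simpleRoots n) (hQ : ΘQ ⊆ DoubleMoment.TypeB.simpleRoots n)
    (𝒟 : DoubleMoment.DoubleMomentGraph
      (DoubleMoment.TypeB.roots n) (DoubleMoment.TypeB.simpleRoots n) ΘQ ΘP) :
    𝒟.IsClosed ↔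
      ((∃ p q : Fin n, ΘP = {β | ∃ i, p ≤ i ∧ β = DoubleMoment.TypeB.simpleRoot i} ∧
          ΘQ = {β | ∃ i, q ≤ i ∧ β = DoubleMoment.TypeB.simpleRoot i}) ∨
        (DoubleMoment.TypeB.simpleRoot (⟨n - 1, by omega⟩ : Fin n) ∉ ΘP ∧
          DoubleMoment.TypeB.simpleRoot (⟨n - 1, by omega⟩ : Fin n) ∉ ΘQ) ∨
        (ΘP = DoubleMoment.TypeB.simpleRoots n ∨ ΘQ = DoubleMoment.TypeB.simpleRoots n) ∨
        (ΘP = ∅ ∨ ΘQ = ∅)) := by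
  have hΦ := isRootBase n
  obtain ⟨v, hv⟩ := hΦ.exists_weight ΘP hP
  obtain ⟨u, hu⟩ := hΦ.exists_weight ΘQ hQ
  rw [hΦ.isClosed_iff_edgesConjugate hP hQ hv hu]
  have hlast : ∀ {S : Set (EuclideanSpace ℝ (Fin n))} {x}, IsWeight (simpleRoots n) S x →
      (simpleRoot (⟨n - 1, by omega⟩ : Fin n) ∈ S ↔ x ⟨n - 1, by omega⟩ = 0) := by
    intro S x hx
    rw [simpleRoot_mem_iff hx, inner_simpleRoot, dif_neg (by simp; omega), sub_zero]
  have hle : ∀ i : Fin n, i ≤ ⟨n - 1, by omega⟩ := fun i => by rw [Fin.le_def]; simp; omega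
  have hne : ∀ {S : Set (EuclideanSpace ℝ (Fin n))} {x}, IsWeight (simpleRoots n) S x →
      simpleRoot (⟨n - 1, by omega⟩ : Fin n) ∉ S → ∀ i, x i ≠ 0 := by
    intro S x hx h i h0
    rw [hlast hx] at h
    exact h (le_antisymm (h0 ▸ weight_apply_antitone hx (hle i)) (weight_apply_nonneg hx _))
  constructor
  · intro h
    by_contra! hcon
    obtain ⟨h1, h2, ⟨hP1, hQ1⟩, hP0, hQ0⟩ := hcon
    obtain ⟨a, ha⟩ := exists_apply_ne_zero hv hP hP1
    obtain ⟨i, hi⟩ := exists_apply_ne_zero hu hQ hQ1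
    have hPseg : simpleRoot (⟨n - 1, by omega⟩ : Fin n) ∈ ΘQ →
        ∃ p : Fin n, ΘP = {β | ∃ i, p ≤ i ∧ β = simpleRoot i} := fun hl =>
      ((injective_off_zero_iff hv hP).1 fun _ _ hab hvab =>
        left_injective_of_edgesConjugate h hu hv hi ((hlast hu).1 hl) hab hvab).resolve_left
        (Set.nonempty_iff_ne_empty.1 hP0)
    have hQseg : simpleRoot (⟨n - 1, by omega⟩ : Fin n) ∈ ΘP →
        ∃ p : Fin n, ΘQ = {β | ∃ i, p ≤ i ∧ β = simpleRoot i} := fun hl =>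
      ((injective_off_zero_iff hu hQ).1 fun _ _ hab hvab =>
        right_injective_of_edgesConjugate h hu hv ha ((hlast hv).1 hl) hab hvab).resolve_left
        (Set.nonempty_iff_ne_empty.1 hQ0)
    -- A final segment contains the last simple root. So as soon as one of the two subsets contains
    -- it, the two implications feed each other and both subsets are final segments.
    by_cases hl : simpleRoot (⟨n - 1, by omega⟩ : Fin n) ∈ ΘP
    · obtain ⟨q, hq⟩ := hQseg hl
      obtain ⟨p, hp⟩ := hPseg (by rw [hq]; exact ⟨_, hle q, rfl⟩)
      exact h1 p q hp hq
    · obtain ⟨p, hp⟩ := hPseg (h2 hl)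
      exact hl (by rw [hp]; exact ⟨_, hle p, rfl⟩)
  · rintro (⟨p, q, hp, hq⟩ | ⟨h1, h2⟩ | (rfl | rfl) | rfl | rfl)
    · exact edgesConjugate_of_injective hQ hv hu
        ((injective_off_zero_iff hv hP).2 (Or.inr ⟨p, hp⟩))
        ((injective_off_zero_iff hu hQ).2 (Or.inr ⟨q, hq⟩))
    · exact edgesConjugate_of_ne_zero hQ hu (hne hv h1) (hne hu h2)
    · exact IsRootBase.edgesConjugate_of_left_eq hv
    · exact IsRootBase.edgesConjugate_of_right_eq hu
    · exact hΦ.edgesConjugate_of_left_empty hv hQ hu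
    · exact hΦ.edgesConjugate_of_right_empty
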